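/- Let $v_0,\dots,v_{n-1}$ ($n\ge 3$) be the vertices of a convex polygon in the Euclidean plane, listed counterclockwise (indices modulo $n$, all vertices other than $v_j,v_{j+1}$ lying strictly to the left of the line directed from $v_j$ to $v_{j+1}$), let $e_j=\overline{v_jv_{j+1}}$ be its edges, and let the obstacle $O$ be the open convex region bounded by the polygon. A path is a continuous map from $[0,1]$ to the plane; its length is its arc length; it is legal if it avoids $O$; it is polygonal if it is piecewise affine with finitely many pieces. Let $p_s,p_\tau\in\mathbb{R}^2\setminus O$ be two points that do not see each other, i.e. $\overline{p_sp_\tau}\cap O\neq\emptyset$. For a point $p\notin O$, call a vertex $v\ne p$ with $\overline{pv}\cap O=\emptyset$ a left (right) tangent vertex from $p$ if $O$ lies to the left (right) of the line directed from $p$ to $v$; the furthest seen vertex from $p$ with $O$ on the left (right) is the left (right) tangent vertex at maximal distance from $p$. Then for each of $p=p_s,p_\tau$ and each side this vertex exists and is unique. Define two sets and two half planes as follows. * Counterclockwise: let $v_i$ be the furthest seen vertex from $p_s$ with $O$ on the left and $v_q$ the furthest seen vertex from $p_\tau$ with $O$ on the right, and put $B_{ccw}=\overline{p_sv_i}\cup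 e_i\cup e_{i+1}\cup\dots\cup e_{q-1}\cup\overline{v_qp_\tau}$ (indices modulo $n$, no edges if $i=q$). Let $H_{ccw}$ be the closed half plane to the right of the line directed from $p_s$ to $p_\tau$. * Clockwise: let $v_{i'}$ be the furthest seen vertex from $p_s$ with $O$ on the right and $v_{q'}$ the furthest seen vertex from $p_\tau$ with $O$ on the left, and put $B_{cw}=\overline{p_sv_{i'}}\cup e_{q'}\cup e_{q'+1}\cup\dots\cup e_{i'-1}\cup\overline{v_{q'}p_\tau}$ (indices modulo $n$, no edges if $i'=q'$). Let $H_{cw}$ be the closed half plane to the left of the line directed from $p_s$ to $p_\tau$. Let $|B_d|$ be the sum of the lengths of the listed segments and edges, for $d\in\{ccw,cw\}$. Then: 1. For each direction $d$, $B_d$ is the image of a legal polygonal path from $p_s$ to $p_\tau$ inside $H_d$ that has length $|B_d|$ and is shortest among all legal paths from $p_s$ to $p_\tau$ inside $H_d$; and every shortest legal path from $p_s$ to $p_\tau$ inside $H_d$ has image $B_d$. 2. A shortest legal polygonal path from $p_s$ to $p_\tau$ exists. Every such path has image $B_d$ and length $|B_d|$ for one of the two directions $d$, and it is shortest among all legal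 (not necessarily polygonal) paths from $p_s$ to $p_\tau$. -/

import Mathlib

open Set

namespace ConvexObstacle

/-- The Euclidean plane. -/
abbrev Plane : Type := EuclideanSpace ℝ (Fin 2)

/-- Twice the signed area of the triangle `a b c`: positive iff `c` lies strictly to the left of
the line directed from `a` to `b`, zero iff the three points are collinear. -/
def orient (a b c : Plane) : ℝ :=
  (b 0 - a 0) * (c 1 - a 1) - (b 1 - a 1) * (c 0 - a 0)

/-- `P` is a convex polygon with (genuine) vertices `P 0, …, P (n - 1)`, listed counterclockwise:
all the vertices other than the two endpoints of the edge from `P i` to `P (i + 1)` lie strictly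
to the left of that edge (indices modulo `n`). -/
def IsConvexPolygon {n : ℕ} [NeZero n] (P : Polygon Plane n) : Prop :=
  3 ≤ n ∧ ∀ i j : Fin n, j ≠ i → j ≠ i + 1 → 0 < orient (P i) (P (i + 1)) (P j)

/-- The obstacle: the open convex region bounded by the polygon. -/
def obstacle {n : ℕ} (P : Polygon Plane n) : Set Plane :=
  interior (convexHull ℝ (range P.vertices))

/-- The free space. -/
def freeSpace {n : ℕ} (P : Polygon Plane n) : Set Plane :=
  (obstacle P)ᶜ

/-- Two points see each other if the segment between them does not meet the obstacle. -/
def Visible {n : ℕ} (P : Polygon Plane n) (x y : Plane) : Prop :=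
  segment ℝ x y ∩ obstacle P = ∅

/-- The two directions of motion around the obstacle. -/
inductive Direction where
  | ccw : Direction
  | cw : Direction

/-- The opposite direction. -/
def Direction.reverse : Direction → Direction
  | .ccw => .cw
  | .cw => .ccw

/-- `1` for counterclockwise motion (obstacle on the left), `-1` for clockwise motion (obstacle on
the right). -/
def Direction.sign : Direction → ℝ
  | .ccw => 1
  | .cw => -1

/-- The `k`-th vertex is a tangent vertex from `p` for the direction `d`: it is a vertex other than
`p` seen from `p`, and the line through `p` and this vertex is a supporting line of the obstacle,
the obstacle lying to the left (`d = ccw`), resp. to the right (`d = cw`), of somebody moving from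
`p` to the vertex. -/
def IsTangentVertex {n : ℕ} (P : Polygon Plane n) (d : Direction) (p : Plane) (k : Fin n) : Prop :=
  P k ≠ p ∧ Visible P p (P k) ∧ ∀ x ∈ obstacle P, 0 ≤ d.sign * orient p (P k) x

/-- The `k`-th vertex is the furthest vertex seen from `p` in the direction `d`: the furthest of the
tangent vertices (there are two of these if the tangent ray contains an edge). -/
def IsFurthestSeenVertex {n : ℕ} (P : Polygon Plane n) (d : Direction) (p : Plane)
    (k : Fin n) : Prop :=
  IsTangentVertex P d p k ∧ ∀ j, IsTangentVertex P d p j → dist p (P j) ≤ dist p (P k)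

/-- The union of the edges `e_i, e_{i+1}, …, e_{q-1}` (indices modulo `n`), `e_j` being the edge
from `P j` to `P (j + 1)`; it is empty if `i = q`. -/
def edgeChain {n : ℕ} [NeZero n] (P : Polygon Plane n) (i q : Fin n) : Set Plane :=
  ⋃ j ∈ {j : Fin n | j - i < q - i}, segment ℝ (P j) (P (j + 1))

/-- The total length of the edges `e_i, e_{i+1}, …, e_{q-1}` (indices modulo `n`). -/
noncomputable def edgeChainLength {n : ℕ} [NeZero n] (P : Polygon Plane n) (i q : Fin n) : ℝ :=
  ∑ j : Fin n with j - i < q - i, dist (P j) (P (j + 1))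

/-- The edges met when moving along the boundary in the direction `d` from `P i` to `P q`. -/
def boundaryChain {n : ℕ} [NeZero n] (P : Polygon Plane n) : Direction → Fin n → Fin n → Set Plane
  | .ccw, i, q => edgeChain P i q
  | .cw, i, q => edgeChain P q i

/-- The length of the boundary chain. -/
noncomputable def boundaryChainLength {n : ℕ} [NeZero n] (P : Polygon Plane n) :
    Direction → Fin n → Fin n → ℝ
  | .ccw, i, q => edgeChainLength P i q
  | .cw, i, q => edgeChainLength P q i

/-- The set compiled of the segment from `s` to `P i`, the edges met when moving in the direction
`d` from `P i` to `P q`, and the segment from `P q` to `t`. -/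
def detour {n : ℕ} [NeZero n] (P : Polygon Plane n) (d : Direction) (s t : Plane)
    (i q : Fin n) : Set Plane :=
  segment ℝ s (P i) ∪ boundaryChain P d i q ∪ segment ℝ (P q) t

/-- The sum of the lengths of the segments of which the detour is compiled. -/
noncomputable def detourLength {n : ℕ} [NeZero n] (P : Polygon Plane n) (d : Direction)
    (s t : Plane) (i q : Fin n) : ℝ :=
  dist s (P i) + boundaryChainLength P d i q + dist (P q) t

/-- The closed half plane bounded by the line through `s` and `t` in which one passes from `s` to
`t` in the direction `d` around an obstacle between them: the one to the right of the line directed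
from `s` to `t` for `d = ccw`, the one to its left for `d = cw`. -/
def sideHalfPlane (d : Direction) (s t : Plane) : Set Plane :=
  {x | d.sign * orient s t x ≤ 0}

/-- Arc length of a path. -/
noncomputable def pathLength {a b : Plane} (γ : Path a b) : ENNReal :=
  eVariationOn γ univ

/-- Polygonal paths: piecewise affine with finitely many pieces. -/
def IsPolygonalPath {a b : Plane} (γ : Path a b) : Prop :=
  ∃ (m : ℕ) (τ : ℕ → unitInterval), Monotone τ ∧ τ 0 = 0 ∧ τ m = 1 ∧
    ∀ k < m, ∃ u w : Plane, ∀ x ∈ Icc (τ k) (τ (k + 1)), γ x = u + (x : ℝ) • w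

/-- Legal paths from `a` to `b`: those that do not pass through the obstacle. -/
def legalPaths {n : ℕ} (P : Polygon Plane n) (a b : Plane) : Set (Path a b) :=
  {γ | range γ ⊆ freeSpace P}

/-- Legal polygonal paths from `a` to `b`. -/
def legalPolygonalPaths {n : ℕ} (P : Polygon Plane n) (a b : Plane) : Set (Path a b) :=
  {γ | γ ∈ legalPaths P a b ∧ IsPolygonalPath γ}

/-- Legal paths from `a` to `b` that stay in the set `H`. -/
def legalPathsWithin {n : ℕ} (P : Polygon Plane n) (H : Set Plane) (a b : Plane) :
    Set (Path a b) :=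
  {γ | γ ∈ legalPaths P a b ∧ range γ ⊆ H}

/-- `γ` is a shortest path of the family `S`. -/
def IsShortestIn {a b : Plane} (S : Set (Path a b)) (γ : Path a b) : Prop :=
  γ ∈ S ∧ ∀ γ' ∈ S, pathLength γ ≤ pathLength γ'

end ConvexObstacle

open ConvexObstacle

namespace ConvexObstacle

/-! Since `s` and `t` do not see each other, some point `o = lineMap s t r` with `0 < r < 1` lies in
the obstacle. The counterclockwise detour is a chain `W 0 = s, W 1, …, W (m + 1) = t` that is taut
around `o` (`IsTautChain`, `isTautChain_detourPoint`): it makes only left turns, `o` lies strictly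
to the left of every segment, and the inner points lie strictly to the right of the line from `s` to
`t`. As these points are in the closure of the open convex obstacle, everything strictly between `o`
and an inner `W k` is forbidden.

A legal path passing `o` on that side therefore meets the rays from `o` through the `W k` in order,
at points `o + c k • (W k - o)` with `c k ≥ 1` (`IsTautChain.exists_crossings`). Projecting each
segment between successive crossings onto the unit direction of the matching segment of the chain
and summing by parts bounds the length of the path from below by that of the chain plus terms `(c k
- 1) * δ k`. Here `δ k > 0` because the chain turns left at `W k` (`inner_unitDir_sub_pos`,
`sum_dist_le_sum_dist_lineMap`). In case of equality all `c k` are `1`, so the path runs through the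
points `W k` without any excess length, and its image is the chain (`range_eq_of_pathLength_le`).

Reversing paths exchanges the two directions. Every legal path avoids `o`, hence contains an arc
passing `o` on one of the two sides (`exists_passesOn`), so the shorter of the two detours is
shortest among all legal paths. -/

/-! ### Signed areas. -/

lemma orient_rotate (a b c : Plane) : orient a b c = orient b c a := by
  unfold orient; ring

lemma orient_swap (a b c : Plane) : orient b a c = -orient a b c := by
  unfold orient; ring

lemma orient_swap_right (a b c : Plane) : orient a c b = -orient a b c := by
  unfold orient; ring

@[simp] lemma orient_self_right (a b : Plane) : orient a b b = 0 := by
  unfold orient; ring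

@[simp] lemma orient_self_outer (a b : Plane) : orient a b a = 0 := by
  unfold orient; ring

@[simp] lemma orient_self_left (a b : Plane) : orient a a b = 0 := by
  unfold orient; ring

lemma continuous_orient (a b : Plane) : Continuous (orient a b) := by
  unfold orient; fun_prop

lemma orient_lineMap (a b x y : Plane) (r : ℝ) :
    orient a b (AffineMap.lineMap x y r) = (1 - r) * orient a b x + r * orient a b y := by
  simp [orient, AffineMap.lineMap_apply]; ring

lemma orient_combo (a b x y : Plane) {r r' : ℝ} (h : r + r' = 1) :
    orient a b (r • x + r' • y) = r * orient a b x + r' * orient a b y := by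
  obtain rfl : r = 1 - r' := by linarith
  simp [orient]; ring

lemma orient_lineMap_left (s t x : Plane) (r : ℝ) :
    orient (AffineMap.lineMap s t r) s x = -(r * orient s t x) := by
  simp [orient, AffineMap.lineMap_apply]; ring

lemma orient_lineMap_right (s t x : Plane) (r : ℝ) :
    orient (AffineMap.lineMap s t r) t x = (1 - r) * orient s t x := by
  simp [orient, AffineMap.lineMap_apply]; ring

lemma convex_setOf_orient_nonneg (ε : ℝ) (a b : Plane) :
    Convex ℝ {x | 0 ≤ ε * orient a b x} := by
  intro x hx y hy r r' hr hr' h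
  simp only [mem_ofPred_eq] at *
  rw [orient_combo _ _ _ _ h]
  nlinarith [mul_nonneg hr hx, mul_nonneg hr' hy]

lemma inner_eq (v w : Plane) : inner ℝ v w = v 0 * w 0 + v 1 * w 1 := by
  simp [PiLp.inner_apply, Fin.sum_univ_two, mul_comm]

/-- Directions in a half plane are ordered by their angles. -/
lemma orient_trans {o e a b c : Plane} (ha : 0 ≤ orient o e a) (hb : 0 < orient o e b)
    (hc : 0 < orient o e c) (hab : 0 < orient o a b) (hbc : 0 < orient o b c) :
    0 < orient o a c := by
  -- The Plücker relation between the four vectors from `o` to `e`, `a`, `b`, `c`.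
  have key : orient o e b * orient o a c =
      orient o e a * orient o b c + orient o e c * orient o a b := by
    unfold orient; ring
  have : 0 < orient o e b * orient o a c := by
    rw [key]; positivity
  exact (pos_iff_pos_of_mul_pos this).1 hb

/-- A line cannot separate the pairs of opposite vertices of a convex quadrilateral. -/
lemma not_separates_opposite_vertices {a b c d : Plane} (h1 : 0 < orient b c d)
    (h2 : 0 < orient a c d) (h3 : 0 < orient a b d) (h4 : 0 < orient a b c) {x y : Plane}
    (ha : orient x y a < 0) (hb : 0 ≤ orient x y b) (hc : orient x y c < 0)
    (hd : 0 ≤ orient x y d) : False := by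
  -- The affine dependence of four points of the plane, to which the affine function `orient x y` is
  -- applied; both sides carry the same total weight, the doubled area of the quadrilateral.
  have key : orient b c d * orient x y a + orient a b d * orient x y c =
      orient a c d * orient x y b + orient a b c * orient x y d := by
    unfold orient; ring
  nlinarith [mul_pos h1 (neg_pos.2 ha), mul_pos h3 (neg_pos.2 hc), mul_nonneg h2.le hb,
    mul_nonneg h4.le hd]

/-! ### Lengthening a chain of left turns. -/

/-- The unit vector pointing from `a` to `b`. -/
noncomputable def unitDir (a b : Plane) : Plane := (dist a b)⁻¹ • (b - a)

lemma norm_unitDir {a b : Plane} (h : a ≠ b) : ‖unitDir a b‖ = 1 := by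
  have := dist_pos.2 h
  rw [unitDir, norm_smul, norm_inv, Real.norm_of_nonneg this.le, ← dist_eq_norm, dist_comm b a]
  exact inv_mul_cancel₀ this.ne'

lemma inner_unitDir {a b : Plane} (h : a ≠ b) : inner ℝ (unitDir a b) (b - a) = dist a b := by
  have := dist_pos.2 h
  rw [unitDir, real_inner_smul_left, real_inner_self_eq_norm_sq, ← dist_eq_norm, dist_comm b a]
  field_simp

lemma ne_of_orient_pos {a b o : Plane} (h : 0 < orient a b o) : a ≠ b := by
  rintro rfl
  simp at h

/-- A point in the interior of the angle at `b` of a left turn `a b c` lies on the inner side of the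
normal of the outer bisector. -/
lemma inner_unitDir_sub_pos {a b c o : Plane} (h1 : 0 < orient a b o) (h2 : 0 < orient b c o)
    (h3 : 0 < orient a b c) : 0 < inner ℝ (unitDir a b - unitDir b c) (b - o) := by
  have hab := ne_of_orient_pos h1
  have hbc := ne_of_orient_pos h2
  have n1 := norm_unitDir hab
  have n2 := norm_unitDir hbc
  have d1 := inv_pos.2 (dist_pos.2 hab)
  have d2 := inv_pos.2 (dist_pos.2 hbc)
  have k1 : 0 < (unitDir a b) 0 * (o 1 - b 1) - (unitDir a b) 1 * (o 0 - b 0) := by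
    have := mul_pos d1 h1
    unfold orient at this
    simp [unitDir]
    linarith
  have k2 : 0 < (unitDir b c) 0 * (o 1 - b 1) - (unitDir b c) 1 * (o 0 - b 0) := by
    have := mul_pos d2 h2
    unfold orient at this
    simp [unitDir]
    linarith
  have k3 : 0 < (unitDir a b) 0 * (unitDir b c) 1 - (unitDir a b) 1 * (unitDir b c) 0 := by
    have := mul_pos (mul_pos d1 d2) h3
    unfold orient at this
    simp [unitDir]
    linarith
  have m1 : (unitDir a b) 0 * (unitDir a b) 0 + (unitDir a b) 1 * (unitDir a b) 1 = 1 := by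
    rw [← inner_eq, real_inner_self_eq_norm_sq, n1, one_pow]
  have m2 : (unitDir b c) 0 * (unitDir b c) 0 + (unitDir b c) 1 * (unitDir b c) 1 = 1 := by
    rw [← inner_eq, real_inner_self_eq_norm_sq, n2, one_pow]
  rw [inner_eq]
  simp only [PiLp.sub_apply]
  generalize unitDir a b = u at *
  generalize unitDir b c = v at *
  have hlt : u 0 * v 0 + u 1 * v 1 < 1 := by
    nlinarith [sq_nonneg (u 0 - v 0), sq_nonneg (u 1 - v 1), mul_pos k3 k3]
  refine (pos_iff_pos_of_mul_pos (a := u 0 * v 1 - u 1 * v 0) ?_).1 k3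
  -- For unit vectors, `u - v` times the sine of the turning angle is `1 - cos` of that angle times
  -- the quarter turn of `u + v`. The inner product with `b - o` thus reduces to the distances of
  -- `o` from the two lines.
  have key : (u 0 * v 1 - u 1 * v 0) *
      ((u 0 - v 0) * (b 0 - o 0) + (u 1 - v 1) * (b 1 - o 1)) =
      ((v 0 * (o 1 - b 1) - v 1 * (o 0 - b 0)) + (u 0 * (o 1 - b 1) - u 1 * (o 0 - b 0))) *
        (1 - (u 0 * v 0 + u 1 * v 1)) := by
    linear_combination
      (v 0 * (o 1 - b 1) - v 1 * (o 0 - b 0)) * m1 + (u 0 * (o 1 - b 1) - u 1 * (o 0 - b 0)) * m2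
  rw [key]
  exact mul_pos (add_pos k2 k1) (sub_pos.2 hlt)

/-- Pushing the vertices of a chain of left turns away from a point to its left makes the chain
longer, the first variation being controlled by the outer bisectors. -/
lemma sum_dist_add_le {W : ℕ → Plane} {o : Plane} {N : ℕ}
    (hpos : ∀ k < N, 0 < orient (W k) (W (k + 1)) o) {c : ℕ → ℝ} (hc0 : c 0 = 1) :
    ∀ M < N, ∑ k ∈ Finset.range (M + 1), dist (W k) (W (k + 1)) +
        ∑ k ∈ Finset.range M, (c (k + 1) - 1) *
          inner ℝ (unitDir (W k) (W (k + 1)) - unitDir (W (k + 1)) (W (k + 2))) (W (k + 1) - o) +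
        (c (M + 1) - 1) * inner ℝ (unitDir (W M) (W (M + 1))) (W (M + 1) - o) ≤
      ∑ k ∈ Finset.range (M + 1), dist (AffineMap.lineMap o (W k) (c k))
        (AffineMap.lineMap o (W (k + 1)) (c (k + 1))) := by
  -- Cauchy–Schwarz: a moved segment is at least as long as its projection onto the direction of the
  -- original one. Summation by parts then leaves only the boundary term at `M + 1`.
  have step : ∀ M < N, dist (W M) (W (M + 1)) +
      (c (M + 1) - 1) * inner ℝ (unitDir (W M) (W (M + 1))) (W (M + 1) - o) -
      (c M - 1) * inner ℝ (unitDir (W M) (W (M + 1))) (W M - o) ≤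
      dist (AffineMap.lineMap o (W M) (c M) : Plane)
        (AffineMap.lineMap o (W (M + 1)) (c (M + 1))) := by
    intro M hM
    have hne := ne_of_orient_pos (hpos M hM)
    have h := real_inner_le_norm (unitDir (W M) (W (M + 1)))
      ((AffineMap.lineMap o (W (M + 1)) (c (M + 1)) : Plane) - AffineMap.lineMap o (W M) (c M))
    rw [norm_unitDir hne, one_mul, ← dist_eq_norm, dist_comm] at h
    refine le_trans (le_of_eq ?_) h
    rw [← inner_unitDir hne, ← real_inner_smul_right, ← real_inner_smul_right, ← inner_add_right,
      ← inner_sub_right]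
    congr 1
    simp only [AffineMap.lineMap_apply, vsub_eq_sub, vadd_eq_add]
    module
  intro M
  induction M with
  | zero =>
    intro h
    have := step 0 h
    simpa [hc0] using this
  | succ M ih =>
    intro h
    have h1 := ih (by omega)
    have h2 := step (M + 1) h
    rw [Finset.sum_range_succ (fun k => dist (W k) _) (M + 1),
      Finset.sum_range_succ (fun k => (c (k + 1) - 1) * _) M,
      Finset.sum_range_succ (fun k => dist (AffineMap.lineMap o (W k) (c k) : Plane) _) (M + 1),
      inner_sub_left, mul_sub]
    linarith

lemma sum_dist_le_sum_dist_lineMap {W : ℕ → Plane} {o : Plane} {m : ℕ}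
    (hpos : ∀ k < m + 1, 0 < orient (W k) (W (k + 1)) o)
    (hturn : ∀ k < m, 0 < orient (W k) (W (k + 1)) (W (k + 2))) {c : ℕ → ℝ}
    (hc : ∀ k ≤ m + 1, 1 ≤ c k) (hc0 : c 0 = 1) (hcN : c (m + 1) = 1) :
    ∑ k ∈ Finset.range (m + 1), dist (W k) (W (k + 1)) ≤
      ∑ k ∈ Finset.range (m + 1), dist (AffineMap.lineMap o (W k) (c k) : Plane)
        (AffineMap.lineMap o (W (k + 1)) (c (k + 1))) ∧
    (∑ k ∈ Finset.range (m + 1), dist (AffineMap.lineMap o (W k) (c k) : Plane)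
        (AffineMap.lineMap o (W (k + 1)) (c (k + 1))) ≤
      ∑ k ∈ Finset.range (m + 1), dist (W k) (W (k + 1)) → ∀ k ≤ m + 1, c k = 1) := by
  have h := sum_dist_add_le hpos hc0 m (Nat.lt_succ_self m)
  rw [hcN, sub_self, zero_mul, add_zero] at h
  have hδ : ∀ k ∈ Finset.range m, 0 < inner ℝ
      (unitDir (W k) (W (k + 1)) - unitDir (W (k + 1)) (W (k + 2))) (W (k + 1) - o) := by
    intro k hk
    have hk := Finset.mem_range.1 hk
    exact inner_unitDir_sub_pos (hpos k (by omega)) (hpos (k + 1) (by omega)) (hturn k hk)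
  have hnn : ∀ k ∈ Finset.range m, 0 ≤ (c (k + 1) - 1) * inner ℝ
      (unitDir (W k) (W (k + 1)) - unitDir (W (k + 1)) (W (k + 2))) (W (k + 1) - o) := by
    intro k hk
    exact mul_nonneg (sub_nonneg.2 (hc _ (by have := Finset.mem_range.1 hk; omega))) (hδ k hk).le
  have hs := Finset.sum_nonneg hnn
  refine ⟨by linarith, fun hle k hk => ?_⟩
  have hs0 := (Finset.sum_eq_zero_iff_of_nonneg hnn).1 (le_antisymm (by linarith) hs)
  rcases Nat.eq_zero_or_pos k with rfl | hk0
  · exact hc0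
  rcases eq_or_lt_of_le hk with rfl | hk1
  · exact hcN
  obtain ⟨j, rfl⟩ := Nat.exists_eq_succ_of_ne_zero hk0.ne'
  have hj : j ∈ Finset.range m := Finset.mem_range.2 (by omega)
  have := (mul_eq_zero.1 (hs0 j hj)).resolve_right (hδ j hj).ne'
  exact sub_eq_zero.1 this

/-! ### Arc length and polygonal paths. -/

lemma univ_unitInterval : (univ : Set unitInterval) = Icc 0 1 :=
  Eq.symm (eq_univ_of_forall fun x => mem_Icc.2 ⟨x.2.1, x.2.2⟩)

lemma pathLength_symm {a b : Plane} (γ : Path a b) : pathLength γ.symm = pathLength γ := by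
  have h : (γ.symm : unitInterval → Plane) = γ ∘ unitInterval.symm := rfl
  unfold pathLength
  rw [h, eVariationOn.comp_eq_of_antitoneOn]
  · congr 1
    rw [image_univ]
    exact unitInterval.symm_bijective.surjective.range_eq
  · intro x _ y _ hxy
    exact unitInterval.symm_le_symm.2 hxy

lemma IsPolygonalPath.symm {a b : Plane} {γ : Path a b} (h : IsPolygonalPath γ) :
    IsPolygonalPath γ.symm := by
  obtain ⟨m, τ, hτ, h0, h1, hp⟩ := h
  refine ⟨m, fun k => unitInterval.symm (τ (m - k)), ?_, by simp [h1], by simp [h0], ?_⟩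
  · intro x y hxy
    exact unitInterval.symm_le_symm.2 (hτ (by omega))
  · intro k hk
    obtain ⟨u, w, huw⟩ := hp (m - (k + 1)) (by omega)
    refine ⟨u + w, -w, fun x hx => ?_⟩
    have e : m - (k + 1) + 1 = m - k := by omega
    have := huw (unitInterval.symm x) ⟨by
      rw [← unitInterval.symm_le_symm, unitInterval.symm_symm]; exact hx.2, by
      rw [← unitInterval.symm_le_symm, unitInterval.symm_symm, e]; exact hx.1⟩
    rw [Path.symm_apply, Function.comp_apply, this, unitInterval.coe_symm_eq]
    module

lemma isPolygonalPath_segment (a b : Plane) : IsPolygonalPath (Path.segment a b) := by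
  refine ⟨1, fun k => if k = 0 then 0 else 1, ?_, by simp, by simp, ?_⟩
  · intro x y hxy
    dsimp only
    split_ifs with h1 h2
    · exact le_rfl
    · exact zero_le_one
    · omega
    · exact le_rfl
  · intro k hk
    refine ⟨a, b - a, fun x _ => ?_⟩
    simp [Path.segment, AffineMap.lineMap_apply, add_comm]

lemma IsPolygonalPath.trans {a b c : Plane} {γ : Path a b} {γ' : Path b c}
    (h : IsPolygonalPath γ) (h' : IsPolygonalPath γ') : IsPolygonalPath (γ.trans γ') := by
  obtain ⟨m, τ, hτ, h0, h1, hp⟩ := h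
  obtain ⟨m', τ', hτ', h0', h1', hp'⟩ := h'
  have hmax : ∀ k, m ≤ k → τ k = 1 := fun k hk =>
    le_antisymm (τ k).2.2 (h1 ▸ hτ hk)
  -- Truncated subtraction keeps `τ'` at `0` for `k ≤ m`, while `τ` stays at `1` from `m` on, so one
  -- formula serves both halves.
  refine ⟨m + m', fun k => ⟨((τ k : ℝ) + τ' (k - m)) / 2, ?_, ?_⟩, ?_, ?_, ?_, ?_⟩
  · have := (τ k).2.1
    have := (τ' (k - m)).2.1
    positivity
  · have := (τ k).2.2
    have := (τ' (k - m)).2.2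
    linarith
  · intro x y hxy
    have h1 : (τ x : ℝ) ≤ τ y := hτ hxy
    have h2 : (τ' (x - m) : ℝ) ≤ τ' (y - m) := hτ' (by omega)
    refine Subtype.coe_le_coe.1 ?_
    dsimp only
    linarith
  · ext; simp [h0, h0']
  · ext; simp [hmax, h1']
  · intro k hk
    rcases lt_or_ge k m with hkm | hkm
    · obtain ⟨u, w, huw⟩ := hp k hkm
      refine ⟨u, (2 : ℝ) • w, fun x hx => ?_⟩
      have e1 : τ' (k - m) = 0 := by rw [show k - m = 0 by omega, h0']
      have e2 : τ' (k + 1 - m) = 0 := by rw [show k + 1 - m = 0 by omega, h0']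
      have hx1 : (τ k : ℝ) / 2 ≤ x := by simpa [e1] using Subtype.coe_le_coe.2 hx.1
      have hx2 : (x : ℝ) ≤ (τ (k + 1) : ℝ) / 2 := by simpa [e2] using Subtype.coe_le_coe.2 hx.2
      have hx3 := (τ (k + 1)).2.2
      have hle : (x : ℝ) ≤ 1 / 2 := by linarith
      rw [Path.trans_apply, dif_pos hle, huw]
      · simp only [smul_smul]
        rw [mul_comm]
      · exact ⟨Subtype.coe_le_coe.1 (by dsimp; linarith), Subtype.coe_le_coe.1 (by dsimp; linarith)⟩
    · obtain ⟨u, w, huw⟩ := hp' (k - m) (by omega)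
      refine ⟨u - w, (2 : ℝ) • w, fun x hx => ?_⟩
      have hx1 : (1 + (τ' (k - m) : ℝ)) / 2 ≤ x := by
        simpa [hmax k hkm] using Subtype.coe_le_coe.2 hx.1
      have hx2 : (x : ℝ) ≤ (1 + (τ' (k - m + 1) : ℝ)) / 2 := by
        simpa [hmax (k + 1) (by omega), show k + 1 - m = k - m + 1 by omega]
          using Subtype.coe_le_coe.2 hx.2
      have hx3 := (τ' (k - m)).2.1
      have hge : 1 / 2 ≤ (x : ℝ) := by linarith
      have key : (γ.trans γ') x = γ' ⟨2 * (x : ℝ) - 1, unitInterval.two_mul_sub_one_mem_iff.2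
          ⟨hge, x.2.2⟩⟩ := by
        rw [Path.trans_apply]
        split_ifs with hle
        · have : (x : ℝ) = 1 / 2 := le_antisymm hle hge
          simp [this]
        · rfl
      rw [key, huw]
      · dsimp only
        module
      · exact ⟨Subtype.coe_le_coe.1 (by dsimp; linarith), Subtype.coe_le_coe.1 (by dsimp; linarith)⟩

lemma pathLength_trans {a b c : Plane} (γ : Path a b) (γ' : Path b c) :
    pathLength (γ.trans γ') = pathLength γ + pathLength γ' := by
  let h : unitInterval := ⟨1 / 2, by norm_num, by norm_num⟩
  let φ : unitInterval → unitInterval := fun x => projIcc (0 : ℝ) 1 zero_le_one (2 * x)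
  let ψ : unitInterval → unitInterval := fun x => projIcc (0 : ℝ) 1 zero_le_one (2 * x - 1)
  have hφ : Monotone φ := fun x y hxy => monotone_projIcc _ (by
    have : (x : ℝ) ≤ y := hxy
    linarith)
  have hψ : Monotone ψ := fun x y hxy => monotone_projIcc _ (by
    have : (x : ℝ) ≤ y := hxy
    linarith)
  have e1 : eVariationOn (γ.trans γ') (Icc 0 h) = pathLength γ := by
    have : EqOn (γ.trans γ') (γ ∘ φ) (Icc 0 h) := by
      intro x hx
      have hx' : (x : ℝ) ≤ 1 / 2 := hx.2
      rw [Path.trans_apply, dif_pos hx']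
      simp only [Function.comp, φ]
      rw [projIcc_of_mem]
    rw [eVariationOn.congr this, eVariationOn.comp_eq_of_monotoneOn _ _ (hφ.monotoneOn _)]
    unfold pathLength
    congr 1
    refine eq_univ_of_forall fun y => ⟨⟨y / 2, by have := y.2.1; positivity, by
      have := y.2.2; linarith⟩, ⟨?_, ?_⟩, ?_⟩
    · exact Subtype.coe_le_coe.1 (by have := y.2.1; dsimp; positivity)
    · exact Subtype.coe_le_coe.1 (by have := y.2.2; dsimp [h]; linarith)
    · simp only [φ]
      rw [show 2 * ((y : ℝ) / 2) = y by ring, projIcc_val]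
  have e2 : eVariationOn (γ.trans γ') (Icc h 1) = pathLength γ' := by
    have : EqOn (γ.trans γ') (γ' ∘ ψ) (Icc h 1) := by
      intro x hx
      have hx' : 1 / 2 ≤ (x : ℝ) := hx.1
      simp only [Function.comp, ψ]
      rw [Path.trans_apply,
        projIcc_of_mem _ (unitInterval.two_mul_sub_one_mem_iff.2 ⟨hx', x.2.2⟩)]
      split_ifs with hle
      · have : (x : ℝ) = 1 / 2 := le_antisymm hle hx'
        simp [this]
      · rfl
    rw [eVariationOn.congr this, eVariationOn.comp_eq_of_monotoneOn _ _ (hψ.monotoneOn _)]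
    unfold pathLength
    congr 1
    refine eq_univ_of_forall fun y => ⟨⟨(1 + y) / 2, by have := y.2.1; positivity, by
      have := y.2.2; linarith⟩, ⟨?_, ?_⟩, ?_⟩
    · exact Subtype.coe_le_coe.1 (by have := y.2.1; dsimp [h]; linarith)
    · exact Subtype.coe_le_coe.1 (by have := y.2.2; dsimp; linarith)
    · simp only [ψ]
      rw [show 2 * ((1 + (y : ℝ)) / 2) - 1 = y by ring, projIcc_val]
  rw [← e1, ← e2]
  unfold pathLength
  rw [univ_unitInterval]
  have := eVariationOn.Icc_add_Icc (γ.trans γ') (s := univ) (a := 0) (b := h) (c := 1)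
    h.2.1 h.2.2 (mem_univ _)
  simpa using this.symm

lemma pathLength_segment (a b : Plane) : pathLength (Path.segment a b) = edist a b := by
  apply le_antisymm
  · have hl : LipschitzOnWith (nndist a b) (AffineMap.lineMap a b : ℝ → Plane) univ :=
      (lipschitzWith_lineMap a b).lipschitzOnWith
    have h1 := hl.comp_eVariationOn_le (f := AffineMap.lineMap a b)
      (g := ((↑) : unitInterval → ℝ)) (s := univ) (fun _ _ => mem_univ _)
    have h2 : eVariationOn ((↑) : unitInterval → ℝ) univ ≤ ENNReal.ofReal (1 - 0) := by
      have := MonotoneOn.eVariationOn_eq (f := ((↑) : unitInterval → ℝ)) (s := univ)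
        (a := 0) (b := 1) (fun x _ y _ h => h) (mem_univ _) (mem_univ _) |>.le
      rw [← univ_unitInterval, inter_self] at this
      simpa using this
    refine h1.trans ?_
    calc _ ≤ (nndist a b : ENNReal) * ENNReal.ofReal (1 - 0) := by gcongr
      _ = _ := by rw [edist_nndist, sub_zero, ENNReal.ofReal_one, mul_one]
  · have := eVariationOn.edist_le (Path.segment a b : unitInterval → Plane)
      (mem_univ (0 : unitInterval)) (mem_univ (1 : unitInterval))
    simpa [pathLength] using this

/-- The concatenation of the segments `W 0 W 1`, …, `W N W (N + 1)`. -/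
lemma exists_isPolygonalPath (W : ℕ → Plane) (N : ℕ) :
    ∃ β : Path (W 0) (W (N + 1)), IsPolygonalPath β ∧
      range β = ⋃ k < N + 1, segment ℝ (W k) (W (k + 1)) ∧
      pathLength β = ENNReal.ofReal (∑ k ∈ Finset.range (N + 1), dist (W k) (W (k + 1))) := by
  induction N with
  | zero =>
    refine ⟨Path.segment _ _, isPolygonalPath_segment _ _, ?_, ?_⟩
    · simp [Path.range_segment]
    · simp [pathLength_segment, edist_dist]
  | succ N ih =>
    obtain ⟨β, h1, h2, h3⟩ := ih
    refine ⟨β.trans (Path.segment _ _), h1.trans (isPolygonalPath_segment _ _), ?_, ?_⟩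
    · rw [Path.trans_range, h2, Path.range_segment, biUnion_lt_succ _ (N + 1)]
    · rw [pathLength_trans, h3, pathLength_segment, Finset.sum_range_succ _ (N + 1),
        ENNReal.ofReal_add (Finset.sum_nonneg fun _ _ => dist_nonneg) dist_nonneg, edist_dist]

lemma sum_dist_le_pathLength {a b : Plane} (γ : Path a b) (τ : ℕ → unitInterval) (hτ : Monotone τ)
    (N : ℕ) :
    ENNReal.ofReal (∑ k ∈ Finset.range N, dist (γ (τ k)) (γ (τ (k + 1)))) ≤ pathLength γ := by
  rw [ENNReal.ofReal_sum_of_nonneg fun _ _ => dist_nonneg]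
  have := eVariationOn.sum_le (f := γ) (s := univ) (n := N) hτ (fun _ => mem_univ _)
  simpa only [edist_comm, edist_dist, pathLength] using this

lemma sum_eVariationOn_Icc (f : unitInterval → Plane) (τ : ℕ → unitInterval) (hτ : Monotone τ)
    (N : ℕ) :
    ∑ k ∈ Finset.range N, eVariationOn f (Icc (τ k) (τ (k + 1))) =
      eVariationOn f (Icc (τ 0) (τ N)) := by
  induction N with
  | zero => simp
  | succ N ih =>
    rw [Finset.sum_range_succ, ih]
    have := eVariationOn.Icc_add_Icc f (s := univ) (a := τ 0) (b := τ N) (c := τ (N + 1))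
      (hτ (Nat.zero_le _)) (hτ (Nat.le_succ _)) (mem_univ _)
    simpa using this

/-- Equality in the triangle inequality puts every point of such an arc on the segment. The arc
omits no point of the segment because its projection onto the direction of the segment takes all
intermediate values. -/
lemma image_Icc_eq_segment {a b : Plane} (γ : Path a b) {x y : unitInterval} (hxy : x ≤ y)
    (h : eVariationOn γ (Icc x y) ≤ edist (γ x) (γ y)) :
    γ '' Icc x y = segment ℝ (γ x) (γ y) := by
  have hsub : γ '' Icc x y ⊆ segment ℝ (γ x) (γ y) := by
    rintro _ ⟨z, hz, rfl⟩
    have h1 := eVariationOn.edist_le γ (s := Icc x z) (left_mem_Icc.2 hz.1) (right_mem_Icc.2 hz.1)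
    have h2 := eVariationOn.edist_le γ (s := Icc z y) (left_mem_Icc.2 hz.2) (right_mem_Icc.2 hz.2)
    have h3 := eVariationOn.Icc_add_Icc γ (s := univ) hz.1 hz.2 (mem_univ _)
    simp only [univ_inter] at h3
    have h4 : edist (γ x) (γ z) + edist (γ z) (γ y) ≤ edist (γ x) (γ y) :=
      (add_le_add h1 h2).trans (h3.le.trans h)
    rw [edist_dist, edist_dist, edist_dist, ← ENNReal.ofReal_add dist_nonneg dist_nonneg,
      ENNReal.ofReal_le_ofReal_iff dist_nonneg] at h4
    have h5 : dist (γ x) (γ z) + dist (γ z) (γ y) = dist (γ x) (γ y) :=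
      le_antisymm h4 (dist_triangle _ _ _)
    rw [dist_add_dist_eq_iff] at h5
    exact mem_segment_iff_wbtw.2 h5
  refine hsub.antisymm ?_
  have hconn : IsPreconnected (γ '' Icc x y) :=
    isPreconnected_Icc.image _ γ.continuous.continuousOn
  rcases eq_or_ne (γ x) (γ y) with he | hne
  · rw [← he, segment_same, singleton_subset_iff]
    exact ⟨x, left_mem_Icc.2 hxy, rfl⟩
  intro p hp
  have hf : Continuous fun v : Plane => inner ℝ (γ y - γ x) v := by fun_prop
  have hI := hconn.intermediate_value (f := fun v : Plane => inner ℝ (γ y - γ x) v)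
    (mem_image_of_mem γ (left_mem_Icc.2 hxy)) (mem_image_of_mem γ (right_mem_Icc.2 hxy))
    hf.continuousOn
  rw [segment_eq_image'] at hp
  obtain ⟨θ, hθ, rfl⟩ := hp
  have hn : 0 < inner ℝ (γ y - γ x) (γ y - γ x) := by
    rw [real_inner_self_eq_norm_sq]
    have := norm_pos_iff.2 (sub_ne_zero.2 hne.symm)
    positivity
  have hin : inner ℝ (γ y - γ x) (γ y) =
      inner ℝ (γ y - γ x) (γ x) + inner ℝ (γ y - γ x) (γ y - γ x) := by
    rw [← inner_add_right]; congr 1; abel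
  obtain ⟨q, hq, hqe⟩ := hI (a := inner ℝ (γ y - γ x) (γ x + θ • (γ y - γ x))) (by
    rw [inner_add_right, inner_smul_right, mem_Icc, hin]
    constructor
    · nlinarith [hθ.1]
    · nlinarith [hθ.2])
  have hq' := hsub hq
  rw [segment_eq_image'] at hq'
  obtain ⟨θ', hθ', rfl⟩ := hq'
  dsimp only at hqe hq
  rw [inner_add_right, inner_add_right, inner_smul_right, inner_smul_right] at hqe
  have : θ' = θ := mul_right_cancel₀ hn.ne' (by linarith)
  rwa [← this]

/-- A path which is not longer than the polygonal chain through points which it passes in order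
runs through this chain. -/
lemma range_eq_of_pathLength_le {a b : Plane} (γ : Path a b) (W : ℕ → Plane)
    (τ : ℕ → unitInterval) (hτ : Monotone τ) (N : ℕ) (h0 : τ 0 = 0) (h1 : τ N = 1)
    (hW : ∀ k ≤ N, γ (τ k) = W k)
    (hlen : pathLength γ ≤
      ENNReal.ofReal (∑ k ∈ Finset.range N, dist (W k) (W (k + 1)))) :
    range γ = ⋃ k < N, segment ℝ (W k) (W (k + 1)) := by
  have hle : ∀ k ∈ Finset.range N, edist (W k) (W (k + 1)) ≤
      eVariationOn γ (Icc (τ k) (τ (k + 1))) := by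
    intro k hk
    have hk := Finset.mem_range.1 hk
    rw [← hW k hk.le, ← hW (k + 1) hk]
    exact eVariationOn.edist_le γ (left_mem_Icc.2 (hτ k.le_succ)) (right_mem_Icc.2 (hτ k.le_succ))
  have hsum : ∑ k ∈ Finset.range N, eVariationOn γ (Icc (τ k) (τ (k + 1))) ≤
      ∑ k ∈ Finset.range N, edist (W k) (W (k + 1)) := by
    rw [sum_eVariationOn_Icc γ τ hτ, h0, h1, ← univ_unitInterval]
    refine hlen.trans ?_
    rw [ENNReal.ofReal_sum_of_nonneg fun _ _ => dist_nonneg]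
    simp only [edist_dist, le_refl]
  -- An excess on one piece could not be made up for by the others, the sums of distances being
  -- finite.
  have hge : ∀ k < N, eVariationOn γ (Icc (τ k) (τ (k + 1))) ≤ edist (W k) (W (k + 1)) := by
    intro k hk
    by_contra! hlt
    have hk' := Finset.mem_range.2 hk
    refine absurd hsum (not_le.2 ?_)
    rw [← Finset.add_sum_erase _ _ hk', ← Finset.add_sum_erase _ _ hk']
    refine ENNReal.add_lt_add_of_lt_of_le ?_ hlt
      (Finset.sum_le_sum fun j hj => hle j (Finset.mem_of_mem_erase hj))
    exact (ENNReal.sum_lt_top.2 fun j _ => edist_lt_top _ _).ne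
  -- Half-open, so that the empty union is no exception; the parameter `1` is treated separately
  -- below.
  have hcov : ∀ M, ⋃ k < M, Icc (τ k) (τ (k + 1)) ⊇ Ico (τ 0) (τ M) := by
    intro M
    induction M with
    | zero => simp
    | succ M ih =>
      rw [biUnion_lt_succ]
      intro x hx
      rcases lt_or_ge x (τ M) with h | h
      · exact Or.inl (ih ⟨hx.1, h⟩)
      · exact Or.inr ⟨h, hx.2.le⟩
  have himg : ∀ k < N, γ '' Icc (τ k) (τ (k + 1)) = segment ℝ (W k) (W (k + 1)) := by
    intro k hk
    rw [← hW k hk.le, ← hW (k + 1) hk]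
    apply image_Icc_eq_segment γ (hτ k.le_succ)
    rw [hW k hk.le, hW (k + 1) hk]
    exact hge k hk
  apply Subset.antisymm
  · rintro _ ⟨x, rfl⟩
    rcases eq_or_lt_of_le (show x ≤ 1 from x.2.2) with rfl | hx
    · obtain ⟨M, rfl⟩ : ∃ M, N = M + 1 := Nat.exists_eq_succ_of_ne_zero (by
        rintro rfl
        exact zero_ne_one (h0.symm.trans h1))
      simp only [mem_iUnion]
      refine ⟨M, M.lt_succ_self, ?_⟩
      rw [← h1, hW _ le_rfl]
      exact right_mem_segment _ _ _
    · have := hcov N ⟨(h0 ▸ x.2.1 : τ 0 ≤ x), by rwa [h1]⟩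
      simp only [mem_iUnion] at this ⊢
      obtain ⟨k, hk, hxk⟩ := this
      exact ⟨k, hk, himg k hk ▸ mem_image_of_mem γ hxk⟩
  · refine iUnion₂_subset fun k hk => ?_
    rw [← himg k hk]
    exact image_subset_range _ _

lemma Direction.sign_ne_zero (d : Direction) : d.sign ≠ 0 := by
  cases d <;> simp [Direction.sign]

/-! ### Tangents to the obstacle. -/

section Obstacle

variable {n : ℕ} {P : Polygon Plane n}

lemma isOpen_obstacle : IsOpen (obstacle P) := isOpen_interior

lemma convex_obstacle : Convex ℝ (obstacle P) := (convex_convexHull ℝ _).interior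

lemma vertex_mem_closure_obstacle (hO : (obstacle P).Nonempty) (j : Fin n) :
    P j ∈ closure (obstacle P) := by
  rw [obstacle, (convex_convexHull ℝ _).closure_interior_eq_closure_of_nonempty_interior hO]
  exact subset_closure (subset_convexHull ℝ _ (mem_range_self j))

lemma orient_nonneg_of_vertices {ε : ℝ} {a b : Plane} (h : ∀ j, 0 ≤ ε * orient a b (P j)) :
    ∀ x ∈ obstacle P, 0 ≤ ε * orient a b x := by
  intro x hx
  refine convexHull_min ?_ (convex_setOf_orient_nonneg ε a b) (interior_subset hx)
  rintro _ ⟨j, rfl⟩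
  exact h j

lemma orient_vertex_nonneg (hO : (obstacle P).Nonempty) {ε : ℝ} {a b : Plane}
    (h : ∀ x ∈ obstacle P, 0 ≤ ε * orient a b x) (j : Fin n) : 0 ≤ ε * orient a b (P j) := by
  have hc : IsClosed {x | 0 ≤ ε * orient a b x} :=
    isClosed_le continuous_const (continuous_const.mul (continuous_orient a b))
  exact closure_minimal h hc (vertex_mem_closure_obstacle hO j)

/-- The obstacle is open: a point of it on the line could be moved slightly along the normal to the
wrong side. -/
lemma orient_pos_of_nonneg {ε : ℝ} (hε : ε ≠ 0) {a b : Plane} (hab : a ≠ b)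
    (h : ∀ x ∈ obstacle P, 0 ≤ ε * orient a b x) {x : Plane} (hx : x ∈ obstacle P) :
    0 < ε * orient a b x := by
  refine (h x hx).lt_of_ne' fun h0 => ?_
  let v : Plane := (-ε) • !₂[-(b 1 - a 1), b 0 - a 0]
  have hcont : Continuous fun r : ℝ => x + r • v := by fun_prop
  have hev : ∀ᶠ r in nhdsWithin (0 : ℝ) (Ioi 0), x + r • v ∈ obstacle P := by
    refine (hcont.tendsto 0).eventually (isOpen_obstacle.mem_nhds ?_) |>.filter_mono
      nhdsWithin_le_nhds
    simpa using hx
  obtain ⟨r, hr, hr0⟩ := (hev.and self_mem_nhdsWithin).exists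
  have h1 := h _ hr
  have h2 : ε * orient a b (x + r • v) =
      ε * orient a b x - r * ε ^ 2 * ((b 0 - a 0) ^ 2 + (b 1 - a 1) ^ 2) := by
    simp [orient, v]; ring
  have h3 : 0 < (b 0 - a 0) ^ 2 + (b 1 - a 1) ^ 2 := by
    have := dist_pos.2 hab
    rw [EuclideanSpace.dist_eq, Real.sqrt_pos, Fin.sum_univ_two, Real.dist_eq, Real.dist_eq,
      sq_abs, sq_abs] at this
    linarith
  have h4 : 0 < r * ε ^ 2 * ((b 0 - a 0) ^ 2 + (b 1 - a 1) ^ 2) :=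
    mul_pos (mul_pos hr0 (by positivity)) h3
  linarith

lemma visible_of_orient_nonneg {ε : ℝ} (hε : ε ≠ 0) {a b : Plane} (hab : a ≠ b)
    (h : ∀ x ∈ obstacle P, 0 ≤ ε * orient a b x) : Visible P a b := by
  refine eq_empty_of_forall_notMem fun x hx => ?_
  have h1 := orient_pos_of_nonneg hε hab h hx.2
  obtain ⟨r, -, rfl⟩ := (segment_eq_image_lineMap ℝ a b) ▸ hx.1
  rw [orient_lineMap] at h1
  simp at h1

lemma lineMap_mem_obstacle {o : Plane} (ho : o ∈ obstacle P) {w : Plane}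
    (hw : w ∈ closure (obstacle P)) {c : ℝ} (h0 : 0 ≤ c) (h1 : c < 1) :
    AffineMap.lineMap o w c ∈ obstacle P := by
  have := (convex_obstacle (P := P)).combo_interior_closure_mem_interior
    (isOpen_obstacle.interior_eq.symm ▸ ho) hw (sub_pos.2 h1) h0 (sub_add_cancel 1 c)
  rw [isOpen_obstacle.interior_eq] at this
  rwa [AffineMap.lineMap_apply_module]

/-- Among finitely many points of a half plane bounded by a line through `p` there is one such that
all of them are on one given side of the line joining it to `p`. -/
lemma exists_extreme_direction {p e : Plane} {v : Fin n → Plane} {ε : ℝ}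
    (h : ∀ j, 0 ≤ orient p e (v j)) (h0 : ∃ j, 0 < orient p e (v j)) :
    ∃ k, v k ≠ p ∧ ∀ j, 0 ≤ ε * orient p (v k) (v j) := by
  obtain ⟨j₀, hj₀⟩ := h0
  have hpe := ne_of_orient_pos hj₀
  have hn : 0 < inner ℝ (e - p) (e - p) := by
    rw [real_inner_self_eq_norm_sq]
    have := norm_pos_iff.2 (sub_ne_zero.2 hpe.symm)
    positivity
  have key : ∀ x y : Plane, inner ℝ (e - p) (e - p) * (ε * orient p x y) =
      ε * inner ℝ (e - p) (x - p) * orient p e y -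
        orient p e x * (ε * inner ℝ (e - p) (y - p)) := by
    intro x y
    simp only [inner_eq, orient, PiLp.sub_apply]
    ring
  have conv : ∀ x y : Plane, 0 ≤ ε * inner ℝ (e - p) (x - p) * orient p e y -
      orient p e x * (ε * inner ℝ (e - p) (y - p)) → 0 ≤ ε * orient p x y := by
    intro x y hxy
    rw [← key] at hxy
    exact nonneg_of_mul_nonneg_right hxy hn
  -- A point on the extreme half of the bounding line wins at once. Otherwise the winner maximizes
  -- the (signed) cotangent of the angle with `e - p` among the points off this line.
  by_cases hA : ∃ k, orient p e (v k) = 0 ∧ 0 < ε * inner ℝ (e - p) (v k - p)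
  · obtain ⟨k, hk, hk'⟩ := hA
    refine ⟨k, ?_, fun j => conv _ _ ?_⟩
    · intro hkp
      simp [hkp] at hk'
    · rw [hk, zero_mul, sub_zero]
      exact mul_nonneg hk'.le (h j)
  · push Not at hA
    obtain ⟨k, hk, hmax⟩ := Finset.exists_max_image
      (Finset.univ.filter fun j => 0 < orient p e (v j))
      (fun j => ε * inner ℝ (e - p) (v j - p) / orient p e (v j)) ⟨j₀, by simpa using hj₀⟩
    have hk : 0 < orient p e (v k) := by simpa using hk
    refine ⟨k, ?_, fun j => conv _ _ ?_⟩
    · intro hkp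
      simp [hkp] at hk
    · rcases (h j).eq_or_lt with hj | hj
      · rw [← hj, mul_zero, zero_sub, neg_nonneg]
        exact mul_nonpos_of_nonneg_of_nonpos hk.le (hA j hj.symm)
      · have := hmax j (by simpa using hj)
        rw [div_le_div_iff₀ hj hk] at this
        linarith

lemma exists_isTangentVertex (hO : (obstacle P).Nonempty) {p : Plane} (hp : p ∈ freeSpace P)
    (d : Direction) : ∃ k, IsTangentVertex P d p k := by
  obtain ⟨f, hf⟩ := geometric_hahn_banach_point_open convex_obstacle isOpen_obstacle hp
  let w := (InnerProductSpace.toDual ℝ Plane).symm f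
  -- `e - p` is the gradient of the separating functional turned by a right angle, which makes
  -- `orient p e` equal to `f - f p`.
  let e : Plane := !₂[p 0 + w 1, p 1 - w 0]
  have he : ∀ x, orient p e x = f x - f p := by
    intro x
    rw [← InnerProductSpace.toDual_symm_apply (y := f) (x := x),
      ← InnerProductSpace.toDual_symm_apply (y := f) (x := p), inner_eq, inner_eq]
    simp [orient, e, w]
    ring
  have hpos : ∀ x ∈ obstacle P, 0 < orient p e x := fun x hx => by
    rw [he]; exact sub_pos.2 (hf x hx)
  obtain ⟨k, hk, hk'⟩ := exists_extreme_direction (p := p) (e := e) (v := P)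
    (ε := d.sign)
    (fun j => by
      simpa using orient_vertex_nonneg (ε := 1) hO (fun x hx => by simpa using (hpos x hx).le) j)
    (by
      by_contra! hall
      obtain ⟨o, ho⟩ := hO
      have := orient_nonneg_of_vertices (ε := -1) (a := p) (b := e)
        (fun j => by linarith [hall j]) o ho
      linarith [hpos o ho])
  have := orient_nonneg_of_vertices hk'
  exact ⟨k, hk, visible_of_orient_nonneg d.sign_ne_zero hk.symm this, this⟩

lemma exists_isFurthestSeenVertex (hO : (obstacle P).Nonempty) {p : Plane} (hp : p ∈ freeSpace P)
    (d : Direction) : ∃ k, IsFurthestSeenVertex P d p k := by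
  obtain ⟨k, hk, hmax⟩ := exists_max_image {k | IsTangentVertex P d p k} (fun k => dist p (P k))
    (toFinite _) (exists_isTangentVertex hO hp d)
  exact ⟨k, hk, hmax⟩

lemma IsTangentVertex.orient_pos {d : Direction} {p : Plane} {k : Fin n}
    (h : IsTangentVertex P d p k) {x : Plane} (hx : x ∈ obstacle P) :
    0 < d.sign * orient p (P k) x :=
  orient_pos_of_nonneg d.sign_ne_zero h.1.symm h.2.2 hx

lemma exists_smul_of_orient_eq_zero {p a b : Plane} (ha : a ≠ p) (h : orient p a b = 0) :
    ∃ r : ℝ, b - p = r • (a - p) := by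
  have hn : (a 0 - p 0) ^ 2 + (a 1 - p 1) ^ 2 ≠ 0 := by
    have := dist_pos.2 ha
    rw [EuclideanSpace.dist_eq, Real.sqrt_pos, Fin.sum_univ_two, Real.dist_eq, Real.dist_eq,
      sq_abs, sq_abs] at this
    exact this.ne'
  refine ⟨((a 0 - p 0) * (b 0 - p 0) + (a 1 - p 1) * (b 1 - p 1)) /
    ((a 0 - p 0) ^ 2 + (a 1 - p 1) ^ 2), ?_⟩
  unfold orient at h
  ext i
  fin_cases i
  · simp
    field_simp
    linear_combination (-(a 1 - p 1)) * h
  · simp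
    field_simp
    linear_combination (a 0 - p 0) * h

lemma IsTangentVertex.orient_eq_zero (hO : (obstacle P).Nonempty) {d : Direction} {p : Plane}
    {j k : Fin n} (hj : IsTangentVertex P d p j) (hk : IsTangentVertex P d p k) :
    orient p (P j) (P k) = 0 := by
  have h1 := orient_vertex_nonneg hO hj.2.2 k
  have h2 := orient_vertex_nonneg hO hk.2.2 j
  rw [orient_swap_right] at h2
  exact (mul_eq_zero.1 (le_antisymm (by linarith) h1)).resolve_left d.sign_ne_zero

lemma orient_eq_mul {p a b : Plane} {r : ℝ} (h : b - p = r • (a - p)) (x : Plane) :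
    orient p b x = r * orient p a x := by
  have h0 : b 0 - p 0 = r * (a 0 - p 0) := by simpa using congrArg (fun v : Plane => v 0) h
  have h1 : b 1 - p 1 = r * (a 1 - p 1) := by simpa using congrArg (fun v : Plane => v 1) h
  unfold orient
  rw [h0, h1]
  ring

/-- Both vertices lie on one line through `p`, on the same ray since the obstacle is on the same
side of both directions, and at the same distance. -/
lemma IsFurthestSeenVertex.point_eq (hO : (obstacle P).Nonempty) {d : Direction} {p : Plane}
    {j k : Fin n} (hj : IsFurthestSeenVertex P d p j) (hk : IsFurthestSeenVertex P d p k) :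
    P j = P k := by
  have hd := le_antisymm (hk.2 j hj.1) (hj.2 k hk.1)
  obtain ⟨r, hr⟩ := exists_smul_of_orient_eq_zero hj.1.1 (hj.1.orient_eq_zero hO hk.1)
  obtain ⟨o, ho⟩ := hO
  have h1 := hj.1.orient_pos ho
  have h2 := hk.1.orient_pos ho
  rw [orient_eq_mul hr, mul_left_comm] at h2
  have hr0 : 0 < r := (pos_iff_pos_of_mul_pos h2).2 h1
  have hn := congrArg norm hr
  rw [norm_smul, Real.norm_of_nonneg hr0.le, ← dist_eq_norm, ← dist_eq_norm, dist_comm _ p,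
    dist_comm _ p, hd] at hn
  have hpos : 0 < dist p (P k) := dist_pos.2 hk.1.1.symm
  have : r = 1 := (mul_right_cancel₀ hpos.ne' (by rw [one_mul]; exact hn)).symm
  rw [this, one_smul] at hr
  exact (sub_left_injective hr).symm

/-- The boundary of the obstacle strictly turns away from the tangent at the furthest seen
vertex. -/
lemma IsFurthestSeenVertex.orient_pos (hO : (obstacle P).Nonempty) {d : Direction} {p o : Plane}
    {j k : Fin n} (hk : IsFurthestSeenVertex P d p k) (ho : o ∈ obstacle P)
    (hj : 0 < d.sign * orient (P k) (P j) o) : 0 < d.sign * orient p (P k) (P j) := by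
  refine (orient_vertex_nonneg hO hk.1.2.2 j).lt_of_ne' fun h0 => ?_
  have h0 := (mul_eq_zero.1 h0).resolve_left d.sign_ne_zero
  obtain ⟨r, hr⟩ := exists_smul_of_orient_eq_zero hk.1.1 h0
  have h1 := hk.1.orient_pos ho
  have e : orient (P k) (P j) o = orient p (P j) o - orient p (P k) o + orient p (P k) (P j) := by
    unfold orient; ring
  rw [e, h0, orient_eq_mul hr, add_zero] at hj
  -- If `P j` were on the tangent, the side on which `o` lies would place it beyond `P k`, making it
  -- a tangent vertex further away.
  have hr1 : 1 < r := by
    by_contra! hle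
    nlinarith
  have hjp : P j ≠ p := by
    intro h
    rw [h, sub_self, eq_comm, smul_eq_zero] at hr
    rcases hr with hr | hr
    · linarith
    · exact hk.1.1 (sub_eq_zero.1 hr)
  have ht : ∀ x ∈ obstacle P, 0 ≤ d.sign * orient p (P j) x := by
    intro x hx
    rw [orient_eq_mul hr, mul_left_comm]
    exact mul_nonneg (by linarith) (hk.1.2.2 x hx)
  have := hk.2 j ⟨hjp, visible_of_orient_nonneg d.sign_ne_zero hjp.symm ht, ht⟩
  rw [dist_comm, dist_eq_norm, hr, norm_smul, Real.norm_of_nonneg (by linarith), dist_comm,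
    dist_eq_norm] at this
  have hpos := norm_pos_iff.2 (sub_ne_zero.2 hk.1.1)
  nlinarith

end Obstacle

/-! ### Cyclic order of the vertices, and the chain between two tangent vertices. -/

section ConvexPolygon

variable {n : ℕ} [NeZero n] {P : Polygon Plane n}

lemma add_ofNat_succ (i : Fin n) (k : ℕ) :
    i + Fin.ofNat n (k + 1) = i + Fin.ofNat n k + 1 := by
  rw [add_assoc]
  congr 1
  ext
  simp [Fin.val_add]

lemma add_ofNat_zero (i : Fin n) : i + Fin.ofNat n 0 = i := by simp

lemma add_ofNat_one (i : Fin n) : i + Fin.ofNat n 1 = i + 1 := by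
  rw [← Nat.zero_add 1, add_ofNat_succ, add_ofNat_zero]

lemma add_ofNat_self (i : Fin n) : i + Fin.ofNat n n = i := by simp

lemma add_ofNat_add_ofNat (i : Fin n) (k l : ℕ) :
    i + Fin.ofNat n k + Fin.ofNat n l = i + Fin.ofNat n (k + l) := by
  rw [add_assoc]
  congr 1
  ext
  simp [Fin.val_add]

lemma add_ofNat_inj {i : Fin n} {k l : ℕ} (hk : k < n) (hl : l < n)
    (h : i + Fin.ofNat n k = i + Fin.ofNat n l) : k = l := by
  have := congrArg Fin.val (add_left_cancel h)
  simpa [Nat.mod_eq_of_lt hk, Nat.mod_eq_of_lt hl] using this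

lemma add_ofNat_sub_val (i j : Fin n) : i + Fin.ofNat n (j - i).val = j := by
  have : Fin.ofNat n (j - i).val = j - i := by
    ext
    simp
  rw [this, add_sub_cancel]

lemma IsConvexPolygon.orient_edge_pos (hP : IsConvexPolygon P) (j : Fin n) {x : Plane}
    (hx : x ∈ obstacle P) : 0 < orient (P j) (P (j + 1)) x := by
  have hlt : 2 < n := hP.1
  have hne : P j ≠ P (j + 1) := by
    have := hP.2 j (j + Fin.ofNat n 2) (fun h => ?_) (fun h => ?_)
    · exact ne_of_orient_pos this
    · exact absurd (add_ofNat_inj (i := j) (l := 0) hlt (by omega)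
        (by rwa [add_ofNat_zero])) (by norm_num)
    · exact absurd (add_ofNat_inj (l := 1) (i := j) hlt (by omega) (by
        rwa [add_ofNat_one])) (by norm_num)
  have := orient_pos_of_nonneg one_ne_zero hne (P := P) (orient_nonneg_of_vertices fun l => ?_) hx
  · simpa using this
  · rw [one_mul]
    by_cases h1 : l = j
    · simp [h1]
    by_cases h2 : l = j + 1
    · simp [h2]
    exact (hP.2 j l h1 h2).le

lemma IsConvexPolygon.injective (hP : IsConvexPolygon P) (hO : (obstacle P).Nonempty) :
    Function.Injective P.vertices := by
  intro i j hij
  by_contra hne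
  by_cases h : j = i + 1
  · obtain ⟨o, ho⟩ := hO
    exact ne_of_orient_pos (hP.orient_edge_pos i ho) (h ▸ hij)
  · have := hP.2 i j (Ne.symm hne) h
    rw [← hij] at this
    simp at this

/-- The vertices of a convex polygon are in convex position. -/
lemma IsConvexPolygon.orient_pos (hP : IsConvexPolygon P) (i : Fin n) {x y : ℕ} (hx : 0 < x)
    (hxy : x < y) (hy : y < n) :
    0 < orient (P i) (P (i + Fin.ofNat n x)) (P (i + Fin.ofNat n y)) := by
  have hE : ∀ k, 1 < k → k < n → 0 < orient (P i) (P (i + 1)) (P (i + Fin.ofNat n k)) := by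
    intro k hk hkn
    apply hP.2 i
    · intro h
      have := add_ofNat_inj (i := i) (l := 0) hkn (by omega) (by rwa [add_ofNat_zero])
      omega
    · intro h
      have := add_ofNat_inj (l := 1) (i := i) hkn (by omega) (by rwa [add_ofNat_one])
      omega
  have hS : ∀ k, 0 < k → k + 1 < n →
      0 < orient (P i) (P (i + Fin.ofNat n k)) (P (i + Fin.ofNat n (k + 1))) := by
    intro k hk hkn
    rw [orient_rotate, add_ofNat_succ]
    apply hP.2
    · intro h
      have := add_ofNat_inj (i := i) (k := 0) (l := k) (by omega) (by omega)
        (by rwa [add_ofNat_zero])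
      omega
    · intro h
      rw [← add_ofNat_succ] at h
      have := add_ofNat_inj (i := i) (k := 0) (l := k + 1) (by omega) (by omega)
        (by rwa [add_ofNat_zero])
      omega
  -- Seen from `P i`, the other vertices form a fan in the half plane left of the first edge; each
  -- consecutive pair turns left, and `orient_trans` adds up the turns.
  induction y, hxy using Nat.le_induction with
  | base => exact hS x hx hy
  | succ y hxy ih =>
    refine orient_trans (e := P (i + 1)) ?_ (hE y (by omega) (by omega)) (hE (y + 1) (by omega) hy)
      (ih (by omega)) (hS y (by omega) hy)
    rcases Nat.lt_or_ge 1 x with h | h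
    · exact (hE x h (by omega)).le
    · obtain rfl : x = 1 := by omega
      rw [add_ofNat_one, orient_self_right]

/-- The part of the boundary between the two tangent vertices does not reach the other side of the
line through the two points from which the tangents are drawn. -/
lemma IsConvexPolygon.orient_chain_neg (hP : IsConvexPolygon P) {s t : Plane} {r : ℝ}
    (hr : 0 < r) (hr' : r < 1) (ho : AffineMap.lineMap s t r ∈ obstacle P) {i q : Fin n}
    (hi : IsTangentVertex P .ccw s i) (hq : IsTangentVertex P .cw t q)
    (hi' : orient s t (P i) < 0) (hq' : orient s t (P q) < 0) {k : ℕ} (hk : k ≤ (q - i).val) :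
    orient s t (P (i + Fin.ofNat n k)) < 0 := by
  by_contra! hnn
  set m := (q - i).val with hm
  have hmn : m < n := (q - i).isLt
  have hqm : i + Fin.ofNat n m = q := add_ofNat_sub_val i q
  have hk0 : 0 < k := Nat.pos_of_ne_zero (by
    rintro rfl
    simp at hnn
    linarith)
  have hkm : k < m := lt_of_le_of_ne hk (by
    rintro rfl
    rw [hqm] at hnn
    linarith)
  -- Otherwise the line through `s` and `t` would separate the diagonal from `P i` to `P q` from the
  -- one joining the vertices at offsets `k` and `l`.
  have hneg : ∀ l, m ≤ l → l < n → orient s t (P (i + Fin.ofNat n l)) < 0 := by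
    intro l hml hln
    by_contra! hl
    have hlm : m < l := lt_of_le_of_ne hml (by
      rintro rfl
      rw [hqm] at hl
      linarith)
    refine not_separates_opposite_vertices (a := P i) (c := P (i + Fin.ofNat n m)) ?_
      (hP.orient_pos i (by omega) hlm hln) (hP.orient_pos i hk0 (by omega) hln)
      (hP.orient_pos i hk0 hkm hmn) hi' hnn (hqm ▸ hq') hl
    have := hP.orient_pos (i + Fin.ofNat n k) (x := m - k) (y := l - k) (by omega) (by omega)
      (by omega)
    rwa [add_ofNat_add_ofNat, add_ofNat_add_ofNat, Nat.add_sub_cancel' (by omega),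
      Nat.add_sub_cancel' (by omega)] at this
  set o : Plane := AffineMap.lineMap s t r with ho'
  have hpos : ∀ x, orient s t x < 0 → 0 < orient o s x := by
    intro x hx
    rw [orient_lineMap_left]
    nlinarith
  -- The vertices from `P q` on round to `P i` all lie in one open half plane bounded by a line
  -- through `o`, and the direction from `o` to them turns left at each edge; at `l = n` the tour is
  -- back at `P i`.
  have hturn : ∀ l, m + 1 ≤ l → l ≤ n → 0 < orient o (P q) (P (i + Fin.ofNat n l)) := by
    intro l hl hln
    induction l, hl using Nat.le_induction with
    | base =>
      rw [add_ofNat_succ, hqm, orient_rotate]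
      exact hP.orient_edge_pos q ho
    | succ l hl ih =>
      refine orient_trans (e := s) (hpos _ hq').le (hpos _ (hneg l (by omega) (by omega)))
        (hpos _ ?_) (ih (by omega)) ?_
      · rcases Nat.lt_or_ge (l + 1) n with h | h
        · exact hneg _ (by omega) h
        · rw [show l + 1 = n by omega, add_ofNat_self]
          exact hi'
      · rw [add_ofNat_succ, orient_rotate]
        exact hP.orient_edge_pos _ ho
  have h1 := hturn n (by omega) le_rfl
  have h2 := orient_vertex_nonneg ⟨_, ho⟩ hi.2.2 q
  have h3 := orient_vertex_nonneg ⟨_, ho⟩ hq.2.2 i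
  -- By the two tangencies neither `s` nor `t` is strictly left of the line from `P q` to `P i`, so
  -- `o` between them cannot be.
  rw [add_ofNat_self, orient_rotate, ho', orient_lineMap] at h1
  rw [orient_swap_right, ← orient_rotate, ← orient_rotate] at h2
  rw [← orient_rotate, ← orient_rotate] at h3
  simp only [Direction.sign] at h2 h3
  nlinarith

/-- The points met in turn by the counterclockwise detour: `s`, the vertices
`P i, P (i + 1), …, P (i + m)`, and `t`. -/
def detourPoint (P : Polygon Plane n) (s t : Plane) (i : Fin n) (m : ℕ) : ℕ → Plane
  | 0 => s
  | k + 1 => if k ≤ m then P (i + Fin.ofNat n k) else t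

lemma sub_lt_iff_exists (i q j : Fin n) :
    j - i < q - i ↔ ∃ k < (q - i).val, i + Fin.ofNat n k = j := by
  constructor
  · intro h
    exact ⟨(j - i).val, h, add_ofNat_sub_val i j⟩
  · rintro ⟨k, hk, rfl⟩
    rw [add_sub_cancel_left, Fin.lt_def]
    simpa [Nat.mod_eq_of_lt (hk.trans (q - i).isLt)] using hk

lemma edgeChain_eq (P : Polygon Plane n) (i q : Fin n) :
    edgeChain P i q = ⋃ k < (q - i).val,
      segment ℝ (P (i + Fin.ofNat n k)) (P (i + Fin.ofNat n (k + 1))) := by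
  ext x
  simp only [edgeChain, mem_iUnion, exists_prop, mem_ofPred_eq, sub_lt_iff_exists]
  constructor
  · rintro ⟨_, ⟨k, hk, rfl⟩, hx⟩
    exact ⟨k, hk, by rwa [add_ofNat_succ]⟩
  · rintro ⟨k, hk, hx⟩
    exact ⟨_, ⟨k, hk, rfl⟩, by rwa [add_ofNat_succ] at hx⟩

lemma edgeChainLength_eq (P : Polygon Plane n) (i q : Fin n) :
    edgeChainLength P i q = ∑ k ∈ Finset.range (q - i).val,
      dist (P (i + Fin.ofNat n k)) (P (i + Fin.ofNat n (k + 1))) := by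
  unfold edgeChainLength
  symm
  refine Finset.sum_bij (fun k _ => i + Fin.ofNat n k) ?_ ?_ ?_ ?_
  · intro k hk
    simp only [Finset.mem_filter, Finset.mem_univ, true_and, sub_lt_iff_exists]
    exact ⟨k, Finset.mem_range.1 hk, rfl⟩
  · intro k hk l hl h
    have hlt := (q - i).isLt
    exact add_ofNat_inj ((Finset.mem_range.1 hk).trans hlt) ((Finset.mem_range.1 hl).trans hlt) h
  · intro j hj
    simp only [Finset.mem_filter, Finset.mem_univ, true_and, sub_lt_iff_exists] at hj
    obtain ⟨k, hk, rfl⟩ := hj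
    exact ⟨k, Finset.mem_range.2 hk, rfl⟩
  · intro k _
    rw [add_ofNat_succ]

lemma detour_ccw_eq (P : Polygon Plane n) (s t : Plane) (i q : Fin n) :
    detour P .ccw s t i q = ⋃ k < (q - i).val + 2, segment ℝ
      (detourPoint P s t i (q - i).val k) (detourPoint P s t i (q - i).val (k + 1)) := by
  rw [biUnion_lt_succ, biUnion_lt_succ', detour, boundaryChain, edgeChain_eq]
  congr 1
  · congr 1
    · simp [detourPoint]
    · refine iUnion₂_congr fun k hk => ?_
      simp [detourPoint, hk.le, Nat.succ_le_of_lt hk]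
  · simp only [detourPoint, le_refl, if_true, Nat.not_succ_le_self, if_false, add_ofNat_sub_val]

lemma detourLength_ccw_eq (P : Polygon Plane n) (s t : Plane) (i q : Fin n) :
    detourLength P .ccw s t i q = ∑ k ∈ Finset.range ((q - i).val + 2), dist
      (detourPoint P s t i (q - i).val k) (detourPoint P s t i (q - i).val (k + 1)) := by
  rw [Finset.sum_range_succ, Finset.sum_range_succ', detourLength, boundaryChainLength,
    edgeChainLength_eq]
  congr 1
  · rw [add_comm]
    congr 1
    · refine Finset.sum_congr rfl fun k hk => ?_
      have hk := Finset.mem_range.1 hk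
      simp [detourPoint, hk.le, Nat.succ_le_of_lt hk]
    · simp [detourPoint]
  · simp only [detourPoint, le_refl, if_true, Nat.not_succ_le_self, if_false, add_ofNat_sub_val]

end ConvexPolygon

/-! ### Taut chains and paths passing them. -/

/-- A chain of left turns from `s` to `t` around the point `lineMap s t r`, to the right of the line
from `s` to `t`, whose inner points lie on the boundary of a set which is star-shaped with respect
to `lineMap s t r`. -/
structure IsTautChain (O : Set Plane) (s t : Plane) (r : ℝ) (W : ℕ → Plane) (m : ℕ) : Prop where
  pos : 0 < r
  lt_one : r < 1
  start : W 0 = s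
  finish : W (m + 1) = t
  left : ∀ k < m + 1, 0 < orient (W k) (W (k + 1)) (AffineMap.lineMap s t r)
  turn : ∀ k < m, 0 < orient (W k) (W (k + 1)) (W (k + 2))
  side : ∀ k, 0 < k → k < m + 1 → orient s t (W k) < 0
  star : ∀ k, 0 < k → k < m + 1 → ∀ c : ℝ, 0 ≤ c → c < 1 →
    AffineMap.lineMap (AffineMap.lineMap s t r : Plane) (W k) c ∈ O

/-- `γ` runs on the side `d` from the ray from `o` through `s` to the ray from `o` through `t`. -/
def PassesOn (d : Direction) (o : Plane) {s t : Plane} (γ : Path s t) : Prop :=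
  ∃ α β : unitInterval, α ≤ β ∧ (∃ a > 0, γ α = AffineMap.lineMap o s (a : ℝ)) ∧
    (∃ b > 0, γ β = AffineMap.lineMap o t (b : ℝ)) ∧ ∀ u ∈ Icc α β, γ u ∈ sideHalfPlane d s t

lemma passesOn_of_range_subset {d : Direction} {s t : Plane} {γ : Path s t}
    (h : range γ ⊆ sideHalfPlane d s t) (o : Plane) : PassesOn d o γ :=
  ⟨0, 1, zero_le_one, ⟨1, one_pos, by simp⟩, ⟨1, one_pos, by simp⟩,
    fun u _ => h (mem_range_self u)⟩

lemma sideHalfPlane_reverse (d : Direction) (s t : Plane) :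
    sideHalfPlane d.reverse t s = sideHalfPlane d s t := by
  ext x
  simp only [sideHalfPlane, mem_ofPred_eq, orient_swap s t]
  cases d <;> simp [Direction.reverse, Direction.sign]

lemma PassesOn.symm {d : Direction} {o s t : Plane} {γ : Path s t} (h : PassesOn d o γ) :
    PassesOn d.reverse o γ.symm := by
  obtain ⟨α, β, hαβ, ha, hb, hside⟩ := h
  refine ⟨unitInterval.symm β, unitInterval.symm α, unitInterval.symm_le_symm.2 hαβ,
    by simpa using hb, by simpa using ha, fun u hu => ?_⟩
  rw [sideHalfPlane_reverse]
  refine hside (unitInterval.symm u) ⟨?_, ?_⟩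
  · rw [← unitInterval.symm_le_symm, unitInterval.symm_symm]; exact hu.2
  · rw [← unitInterval.symm_le_symm, unitInterval.symm_symm]; exact hu.1

/-- A path around a point between `s` and `t` passes this point on one of the two sides. -/
lemma exists_passesOn {s t : Plane} (hst : s ≠ t) {r : ℝ} (h0 : 0 < r) (h1 : r < 1)
    (γ : Path s t) (hγ : ∀ u, γ u ≠ AffineMap.lineMap s t r) :
    ∃ d, PassesOn d (AffineMap.lineMap s t r) γ := by
  set o : Plane := AffineMap.lineMap s t r with ho
  have hn : 0 < inner ℝ (t - s) (t - s) := by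
    rw [real_inner_self_eq_norm_sq]
    have := norm_pos_iff.2 (sub_ne_zero.2 hst.symm)
    positivity
  have hline : ∀ u, orient s t (γ u) = 0 → ∃ ρ : ℝ, γ u = o + ρ • (t - s) ∧
      inner ℝ (t - s) (γ u - o) = ρ * inner ℝ (t - s) (t - s) ∧ ρ ≠ 0 := by
    intro u hu
    obtain ⟨ρ, hρ⟩ := exists_smul_of_orient_eq_zero hst.symm hu
    have e : γ u = o + (ρ - r) • (t - s) := by
      rw [eq_add_of_sub_eq' hρ, ho, AffineMap.lineMap_apply, vsub_eq_sub, vadd_eq_add]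
      module
    refine ⟨ρ - r, e, ?_, fun h => hγ u ?_⟩
    · rw [e, add_sub_cancel_left, real_inner_smul_right]
    · rw [e, h, zero_smul, add_zero]
  have hg : Continuous fun u => orient s t (γ u) := (continuous_orient s t).comp γ.continuous
  have hp : Continuous fun u => inner ℝ (t - s) (γ u - o) := by fun_prop
  have hT : IsClosed {u | orient s t (γ u) = 0 ∧ 0 ≤ inner ℝ (t - s) (γ u - o)} :=
    (isClosed_eq hg continuous_const).inter (isClosed_le continuous_const hp)
  -- `β` is the first time on the ray from `o` towards `t`, and `α` the last time before it on the
  -- ray towards `s`. In between the path does not meet the line. Weak inequalities give closed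
  -- sets, and `o` itself is never met.
  obtain ⟨β, ⟨hβ0, hβp⟩, hβ⟩ := hT.isCompact.exists_isLeast ⟨1, by
    refine ⟨by simp, ?_⟩
    rw [γ.target, show t - o = (1 - r) • (t - s) by
      rw [ho, AffineMap.lineMap_apply, vsub_eq_sub, vadd_eq_add]; module, real_inner_smul_right]
    exact mul_nonneg (by linarith) hn.le⟩
  have hS : IsClosed {u | (orient s t (γ u) = 0 ∧ inner ℝ (t - s) (γ u - o) ≤ 0) ∧ u ≤ β} :=
    ((isClosed_eq hg continuous_const).inter (isClosed_le hp continuous_const)).inter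
      isClosed_Iic
  obtain ⟨α, ⟨⟨hα0, hαp⟩, hαβ⟩, hα⟩ := hS.isCompact.exists_isGreatest ⟨0, by
    refine ⟨⟨by simp, ?_⟩, β.2.1⟩
    rw [γ.source, show s - o = (-r) • (t - s) by
      rw [ho, AffineMap.lineMap_apply, vsub_eq_sub, vadd_eq_add]; module, real_inner_smul_right]
    exact mul_nonpos_of_nonpos_of_nonneg (by linarith) hn.le⟩
  have hne : ∀ u, α < u → u < β → orient s t (γ u) ≠ 0 := by
    intro u hu hu' h
    rcases le_total 0 (inner ℝ (t - s) (γ u - o)) with h' | h'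
    · exact absurd (hβ ⟨h, h'⟩) (not_le.2 hu')
    · exact absurd (hα ⟨⟨h, h'⟩, hu'.le⟩) (not_le.2 hu)
  have hsign : (∀ u ∈ Icc α β, orient s t (γ u) ≤ 0) ∨ ∀ u ∈ Icc α β, 0 ≤ orient s t (γ u) := by
    by_contra! h
    obtain ⟨⟨x, hx, hx0⟩, y, hy, hy0⟩ := h
    rcases le_total x y with hxy | hxy
    · obtain ⟨z, hz, hz0⟩ := intermediate_value_Icc' hxy hg.continuousOn
        ⟨hy0.le, hx0.le⟩
      refine hne z (lt_of_le_of_lt hx.1 (hz.1.lt_of_ne ?_))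
        (lt_of_lt_of_le (hz.2.lt_of_ne ?_) hy.2) hz0
      · rintro rfl; exact hx0.ne' hz0
      · rintro rfl; exact hy0.ne hz0
    · obtain ⟨z, hz, hz0⟩ := intermediate_value_Icc hxy hg.continuousOn
        ⟨hy0.le, hx0.le⟩
      refine hne z (lt_of_le_of_lt hy.1 (hz.1.lt_of_ne ?_))
        (lt_of_lt_of_le (hz.2.lt_of_ne ?_) hx.2) hz0
      · rintro rfl; exact hy0.ne hz0
      · rintro rfl; exact hx0.ne' hz0
  have ha : ∃ a > 0, γ α = AffineMap.lineMap o s (a : ℝ) := by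
    obtain ⟨ρ, e, hρ, hρ0⟩ := hline α hα0
    have hρ' : ρ < 0 := lt_of_le_of_ne (by
      by_contra! h
      exact absurd (hρ ▸ hαp) (not_le.2 (mul_pos h hn))) hρ0
    refine ⟨-ρ / r, div_pos (by linarith) h0, ?_⟩
    have hs : s - o = (-r) • (t - s) := by
      rw [ho, AffineMap.lineMap_apply, vsub_eq_sub, vadd_eq_add]; module
    rw [AffineMap.lineMap_apply, vsub_eq_sub, vadd_eq_add, hs, smul_smul, e, add_comm]
    congr 2
    field_simp
  have hb : ∃ b > 0, γ β = AffineMap.lineMap o t (b : ℝ) := by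
    obtain ⟨ρ, e, hρ, hρ0⟩ := hline β hβ0
    have hρ' : 0 < ρ := lt_of_le_of_ne (by
      by_contra! h
      exact absurd (hρ ▸ hβp) (not_le.2 (mul_neg_of_neg_of_pos h hn))) hρ0.symm
    have hr : 0 < 1 - r := by linarith
    refine ⟨ρ / (1 - r), div_pos hρ' hr, ?_⟩
    have ht : t - o = (1 - r) • (t - s) := by
      rw [ho, AffineMap.lineMap_apply, vsub_eq_sub, vadd_eq_add]; module
    rw [AffineMap.lineMap_apply, vsub_eq_sub, vadd_eq_add, ht, smul_smul, e, add_comm]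
    congr 2
    field_simp
  rcases hsign with h | h
  · exact ⟨.ccw, α, β, hαβ, ha, hb, fun u hu => by
      simpa [sideHalfPlane, Direction.sign] using h u hu⟩
  · exact ⟨.cw, α, β, hαβ, ha, hb, fun u hu => by
      simpa [sideHalfPlane, Direction.sign] using h u hu⟩

/-- After meeting the ray through `W k`, the path is to the right of the line from `o` to `W (k +
1)`, and at `β` to its left, so it crosses that line. The half plane excludes the opposite ray, and
legality excludes points before `W (k + 1)`. -/
lemma IsTautChain.exists_crossings {O : Set Plane} {s t : Plane} {r : ℝ} {W : ℕ → Plane} {m : ℕ}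
    (hW : IsTautChain O s t r W m) {γ : Path s t} (hγ : ∀ u, γ u ∉ O)
    (hpass : PassesOn .ccw (AffineMap.lineMap s t r) γ) :
    ∃ (τ : ℕ → unitInterval) (c : ℕ → ℝ), Monotone τ ∧ τ 0 = 0 ∧ τ (m + 1) = 1 ∧
      c 0 = 1 ∧ c (m + 1) = 1 ∧ ∀ k ≤ m + 1, 1 ≤ c k ∧
        γ (τ k) = AffineMap.lineMap (AffineMap.lineMap s t r : Plane) (W k) (c k) := by
  set o : Plane := AffineMap.lineMap s t r with ho
  obtain ⟨α, β, hαβ, ⟨a, ha, hα⟩, ⟨b, hb, hβ⟩, hside⟩ := hpass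
  have hr := hW.pos
  have hr' := hW.lt_one
  -- At `k = 0` only positivity is available: the path may be at a point of the ray nearer to `o`
  -- than `s` at time `α`.
  let good : ℕ → unitInterval → Prop := fun k u => u ∈ Icc α β ∧ ∃ c : ℝ, 0 < c ∧ (0 < k → 1 ≤ c) ∧
    γ u = AffineMap.lineMap o (W k) c
  have step : ∀ k u, ∃ u', u ≤ u' ∧ (k + 1 < m + 1 → good k u → good (k + 1) u') := by
    intro k u
    by_cases h : k + 1 < m + 1 ∧ good k u
    swap
    · exact ⟨u, le_rfl, fun h1 h2 => absurd ⟨h1, h2⟩ h⟩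
    obtain ⟨hk, hu, c, hc, -, huc⟩ := h
    have hs := hW.side (k + 1) k.succ_pos hk
    have hneg : orient o (W (k + 1)) (γ u) < 0 := by
      have := hW.left k (by omega)
      rw [orient_rotate, orient_rotate] at this
      rw [huc, orient_lineMap, orient_self_outer, orient_swap_right]
      nlinarith
    have hpos : 0 < orient o (W (k + 1)) (γ β) := by
      rw [hβ, orient_lineMap, orient_self_outer, orient_swap_right, ho, orient_lineMap_right]
      have : 0 < b * ((1 - r) * -orient s t (W (k + 1))) :=
        mul_pos hb (mul_pos (by linarith) (by linarith))
      linarith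
    obtain ⟨v, hv, hv0⟩ := intermediate_value_Icc hu.2
      ((continuous_orient o (W (k + 1))).comp γ.continuous).continuousOn ⟨hneg.le, hpos.le⟩
    refine ⟨v, hv.1, fun _ _ => ⟨⟨hu.1.trans hv.1, hv.2⟩, ?_⟩⟩
    have hWo : W (k + 1) ≠ o := by
      intro h
      rw [h, ho, orient_lineMap] at hs
      simp at hs
    obtain ⟨c', hc'⟩ := exists_smul_of_orient_eq_zero hWo hv0
    have e : γ v = AffineMap.lineMap o (W (k + 1)) c' := by
      rw [AffineMap.lineMap_apply, vsub_eq_sub, vadd_eq_add, ← hc']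
      simp
    have hc0 : 0 ≤ c' := by
      have h1 := hside v ⟨hu.1.trans hv.1, hv.2⟩
      simp only [sideHalfPlane, Direction.sign, one_mul, mem_ofPred_eq] at h1
      have h2 : orient s t o = 0 := by rw [ho, orient_lineMap]; simp
      rw [e, orient_lineMap, h2, mul_zero, zero_add] at h1
      by_contra! h
      exact absurd h1 (not_le.2 (mul_pos_of_neg_of_neg h hs))
    have hc1 : 1 ≤ c' := by
      by_contra! h
      exact hγ v (e ▸ hW.star (k + 1) k.succ_pos hk c' hc0 h)
    exact ⟨c', by linarith, fun _ => hc1, e⟩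
  choose f hf hfgood using step
  let σ : ℕ → unitInterval := fun k => Nat.rec α (fun k u => f k u) k
  have hσ : Monotone σ := monotone_nat_of_le_succ fun k => hf k (σ k)
  have hgood : ∀ k < m + 1, good k (σ k) := by
    intro k
    induction k with
    | zero =>
      exact fun _ => ⟨left_mem_Icc.2 hαβ, a, ha, fun h => absurd h (lt_irrefl 0), by
        rw [hW.start]; exact hα⟩
    | succ k ih => exact fun hk => hfgood k (σ k) hk (ih (by omega))
  have hex : ∀ k, ∃ c : ℝ, 0 < k → k < m + 1 → 1 ≤ c ∧
      γ (σ k) = AffineMap.lineMap o (W k) c := by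
    intro k
    by_cases h : 0 < k ∧ k < m + 1
    · obtain ⟨-, c, -, hc, e⟩ := hgood k h.2
      exact ⟨c, fun _ _ => ⟨hc h.1, e⟩⟩
    · exact ⟨0, fun h1 h2 => absurd ⟨h1, h2⟩ h⟩
  choose c hc using hex
  -- The outer times `α` and `β` have done their work; they give way to `0` and `1`, where the path
  -- is at `s` and `t` and the factor is exactly `1`.
  refine ⟨fun k => if k = 0 then 0 else if k < m + 1 then σ k else 1,
    fun k => if k = 0 then 1 else if k < m + 1 then c k else 1, ?_, by simp, by simp, by simp,
    by simp, ?_⟩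
  · intro x y hxy
    dsimp only
    split_ifs <;> first
      | omega
      | exact le_rfl
      | exact unitInterval.nonneg'
      | exact unitInterval.le_one'
      | exact hσ hxy
  · intro k hk
    dsimp only
    split_ifs with h h'
    · subst h
      simp [hW.start]
    · exact hc k (by omega) h'
    · obtain rfl : k = m + 1 := by omega
      simp [hW.finish]

/-- A taut chain is shortest among the paths passing on its side, and the unique such one. -/
lemma IsTautChain.le_pathLength {O : Set Plane} {s t : Plane} {r : ℝ} {W : ℕ → Plane} {m : ℕ}
    (hW : IsTautChain O s t r W m) {γ : Path s t} (hγ : ∀ u, γ u ∉ O)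
    (hpass : PassesOn .ccw (AffineMap.lineMap s t r) γ) :
    ENNReal.ofReal (∑ k ∈ Finset.range (m + 1), dist (W k) (W (k + 1))) ≤ pathLength γ ∧
    (pathLength γ ≤ ENNReal.ofReal (∑ k ∈ Finset.range (m + 1), dist (W k) (W (k + 1))) →
      range γ = ⋃ k < m + 1, segment ℝ (W k) (W (k + 1))) := by
  obtain ⟨τ, c, hτ, hτ0, hτ1, hc0, hc1, hτc⟩ := hW.exists_crossings hγ hpass
  obtain ⟨hle, heq⟩ := sum_dist_le_sum_dist_lineMap hW.left hW.turn (fun k hk => (hτc k hk).1)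
    hc0 hc1
  have hlen := sum_dist_le_pathLength γ τ hτ (m + 1)
  have hsum : ∑ k ∈ Finset.range (m + 1), dist (γ (τ k)) (γ (τ (k + 1))) =
      ∑ k ∈ Finset.range (m + 1),
        dist (AffineMap.lineMap (AffineMap.lineMap s t r : Plane) (W k) (c k) : Plane)
          (AffineMap.lineMap (AffineMap.lineMap s t r : Plane) (W (k + 1)) (c (k + 1))) := by
    refine Finset.sum_congr rfl fun k hk => ?_
    have hk := Finset.mem_range.1 hk
    rw [(hτc k hk.le).2, (hτc (k + 1) hk).2]
  rw [hsum] at hlen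
  refine ⟨(ENNReal.ofReal_le_ofReal hle).trans hlen, fun h => ?_⟩
  have hc := heq ((ENNReal.ofReal_le_ofReal_iff
    (Finset.sum_nonneg fun _ _ => dist_nonneg)).1 (hlen.trans h))
  refine range_eq_of_pathLength_le γ W τ hτ (m + 1) hτ0 hτ1 (fun k hk => ?_) h
  rw [(hτc k hk).2, hc k hk, AffineMap.lineMap_apply_one]

/-! ### Optimality of the two detours. -/

section Main

variable {n : ℕ} {P : Polygon Plane n}

lemma not_mem_obstacle_of_range {s t : Plane} {γ : Path s t} (hγ : γ ∈ legalPaths P s t) (u) :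
    γ u ∉ obstacle P := hγ (mem_range_self u)

lemma exists_lineMap_mem_obstacle {s t : Plane} (hs : s ∈ freeSpace P) (ht : t ∈ freeSpace P)
    (hst : ¬ Visible P s t) :
    ∃ r : ℝ, 0 < r ∧ r < 1 ∧ (AffineMap.lineMap s t r : Plane) ∈ obstacle P := by
  obtain ⟨x, hx, hxO⟩ := nonempty_iff_ne_empty.2 hst
  rw [segment_eq_image_lineMap] at hx
  obtain ⟨r, hr, rfl⟩ := hx
  refine ⟨r, hr.1.lt_of_ne ?_, hr.2.lt_of_ne ?_, hxO⟩
  · rintro rfl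
    exact hs (by simpa using hxO)
  · rintro rfl
    exact ht (by simpa using hxO)

variable [NeZero n]

/-- Choosing the furthest tangent vertices makes the turns at `P i` and `P q` strict: with a nearer
one, the chain could run straight on along an edge contained in the tangent. -/
lemma isTautChain_detourPoint (hP : IsConvexPolygon P) {s t : Plane} {r : ℝ} (hr : 0 < r)
    (hr' : r < 1) (ho : AffineMap.lineMap s t r ∈ obstacle P) {i q : Fin n}
    (hi : IsFurthestSeenVertex P .ccw s i) (hq : IsFurthestSeenVertex P .cw t q) :
    IsTautChain (obstacle P) s t r (detourPoint P s t i (q - i).val) ((q - i).val + 1) := by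
  obtain ⟨m, hm⟩ : ∃ m, (q - i).val = m := ⟨_, rfl⟩
  rw [hm]
  have hO : (obstacle P).Nonempty := ⟨_, ho⟩
  have hqm : i + Fin.ofNat n m = q := hm ▸ add_ofNat_sub_val i q
  have hmn : m < n := hm ▸ (q - i).isLt
  have h1 : 0 < orient s (P i) (AffineMap.lineMap s t r) := by
    simpa [Direction.sign] using hi.1.orient_pos ho
  have h2 : 0 < orient (P q) t (AffineMap.lineMap s t r) := by
    have := hq.1.orient_pos ho
    rw [orient_swap]
    simpa [Direction.sign] using this
  have hi' : orient s t (P i) < 0 := by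
    rw [← orient_rotate, orient_lineMap_left] at h1
    exact neg_of_mul_neg_right (neg_pos.1 h1) hr.le
  have hq' : orient s t (P q) < 0 := by
    rw [← orient_rotate, orient_swap_right, orient_lineMap_right] at h2
    nlinarith
  have hV : ∀ k ≤ m, detourPoint P s t i m (k + 1) = P (i + Fin.ofNat n k) := fun k hk => by
    simp only [detourPoint, if_pos hk]
  have hE : detourPoint P s t i m (m + 2) = t := by simp [detourPoint]
  have hV0 : detourPoint P s t i m 1 = P i := by rw [hV 0 (Nat.zero_le _), add_ofNat_zero]
  have hVm : detourPoint P s t i m (m + 1) = P q := by rw [hV m le_rfl, hqm]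
  refine ⟨hr, hr', rfl, hE, ?_, ?_, ?_, ?_⟩
  · intro k hk
    rcases k with _ | k
    · rw [hV0]
      exact h1
    · rcases Nat.lt_or_ge k m with h | h
      · rw [hV k h.le, hV (k + 1) h, add_ofNat_succ]
        exact hP.orient_edge_pos _ ho
      · obtain rfl : k = m := by omega
        rw [hVm, hE]
        exact h2
  · intro k hk
    rcases k with _ | k
    -- If `i = q`, the only turn is at `P i` between `s` and `t`, and it is a left turn because `P
    -- i` is to the right of the line from `s` to `t`.
    · rcases Nat.eq_zero_or_pos m with h | h
      · have hE' : detourPoint P s t i m 2 = t := by simp [detourPoint, h]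
        rw [Nat.zero_add, hV0, hE', orient_swap_right]
        simpa [detourPoint] using hi'
      · rw [Nat.zero_add, hV0, hV 1 h, add_ofNat_one]
        have := hi.orient_pos (j := i + 1) hO ho (by
          simpa [Direction.sign] using hP.orient_edge_pos i ho)
        simpa [Direction.sign, detourPoint] using this
    · rcases Nat.lt_or_ge (k + 1) m with h | h
      · rw [hV k (by omega), hV (k + 1) h.le, hV (k + 2) h]
        have := hP.orient_pos (i + Fin.ofNat n k) (x := 1) (y := 2) (by omega) (by omega)
          hP.1
        rwa [add_ofNat_add_ofNat, add_ofNat_add_ofNat] at this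
      · obtain rfl : m = k + 1 := by omega
        have hqk : i + Fin.ofNat n k + 1 = q := by rw [← add_ofNat_succ, ← hqm]
        rw [hVm, hE, hV k (by omega)]
        have := hq.orient_pos (j := i + Fin.ofNat n k) hO ho (by
          have := hP.orient_edge_pos (i + Fin.ofNat n k) ho
          rw [hqk] at this
          rw [orient_swap]
          simpa [Direction.sign] using this)
        rw [orient_swap_right] at this
        rw [← orient_rotate]
        simpa [Direction.sign] using this
  · intro k hk0 hk
    obtain ⟨k, rfl⟩ := Nat.exists_eq_succ_of_ne_zero hk0.ne'
    rw [hV k (by omega)]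
    exact hP.orient_chain_neg hr hr' ho hi.1 hq.1 hi' hq' (by omega)
  · intro k hk0 hk c hc0 hc1
    obtain ⟨k, rfl⟩ := Nat.exists_eq_succ_of_ne_zero hk0.ne'
    rw [hV k (by omega)]
    exact lineMap_mem_obstacle ho (vertex_mem_closure_obstacle hO _) hc0 hc1

/-- The properties of the detour in the direction `d`: it is a legal polygonal path on its side,
and the unique shortest one among all the legal paths passing `o` on this side. -/
def IsOptimalDetour (P : Polygon Plane n) (d : Direction) (s t o : Plane) (i q : Fin n) : Prop :=
  (∃ β : Path s t, IsPolygonalPath β ∧ range β = detour P d s t i q ∧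
    pathLength β = ENNReal.ofReal (detourLength P d s t i q) ∧
    β ∈ legalPathsWithin P (sideHalfPlane d s t) s t) ∧
  ∀ γ ∈ legalPaths P s t, PassesOn d o γ →
    ENNReal.ofReal (detourLength P d s t i q) ≤ pathLength γ ∧
    (pathLength γ ≤ ENNReal.ofReal (detourLength P d s t i q) → range γ = detour P d s t i q)

lemma detour_subset_freeSpace (hP : IsConvexPolygon P) (d : Direction) {s t : Plane} {i q : Fin n}
    (hi : Visible P s (P i)) (hq : Visible P t (P q)) : detour P d s t i q ⊆ freeSpace P := by
  have hE : ∀ i q : Fin n, edgeChain P i q ⊆ freeSpace P := by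
    intro i q
    refine iUnion₂_subset fun j _ x hx hxO => ?_
    have hpos := fun y hy => (hP.orient_edge_pos j (x := y) hy)
    have := visible_of_orient_nonneg (P := P) one_ne_zero (ne_of_orient_pos (hpos x hxO))
      (fun y hy => by simpa using (hpos y hy).le)
    exact (eq_empty_iff_forall_notMem.1 this) x ⟨hx, hxO⟩
  rintro x ((hx | hx) | hx) hxO
  · exact (eq_empty_iff_forall_notMem.1 hi) x ⟨hx, hxO⟩
  · cases d <;> exact hE _ _ hx hxO
  · rw [segment_symm] at hx
    exact (eq_empty_iff_forall_notMem.1 hq) x ⟨hx, hxO⟩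

lemma detour_symm (P : Polygon Plane n) (d : Direction) (s t : Plane) (i q : Fin n) :
    detour P d.reverse t s q i = detour P d s t i q := by
  unfold detour
  rw [segment_symm ℝ t, segment_symm ℝ (P i), union_comm, ← union_assoc, union_right_comm,
    union_assoc, ← union_assoc]
  cases d <;> rfl

lemma detourLength_symm (P : Polygon Plane n) (d : Direction) (s t : Plane) (i q : Fin n) :
    detourLength P d.reverse t s q i = detourLength P d s t i q := by
  unfold detourLength
  rw [dist_comm t, dist_comm (P i)]
  have : boundaryChainLength P d.reverse q i = boundaryChainLength P d i q := by cases d <;> rfl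
  rw [this]
  ring

lemma IsOptimalDetour.reverse {d : Direction} {s t o : Plane} {i q : Fin n}
    (h : IsOptimalDetour P d.reverse t s o q i) : IsOptimalDetour P d s t o i q := by
  obtain ⟨⟨β, h1, h2, h3, h4, h5⟩, h6⟩ := h
  rw [detour_symm, detourLength_symm] at *
  constructor
  · refine ⟨β.symm, h1.symm, ?_, ?_, ?_, ?_⟩
    · rw [Path.symm_range, h2]
    · rw [pathLength_symm, h3]
    · exact (Path.symm_range β).trans_subset h4
    · rw [Path.symm_range, ← sideHalfPlane_reverse]
      exact h5
  · intro γ hγ hpass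
    have := h6 γ.symm ((Path.symm_range γ).trans_subset hγ) hpass.symm
    rwa [pathLength_symm, Path.symm_range] at this

lemma IsTautChain.segment_subset {O : Set Plane} {s t : Plane} {r : ℝ} {W : ℕ → Plane} {m : ℕ}
    (hW : IsTautChain O s t r W m) {k : ℕ} (hk : k < m + 1) :
    segment ℝ (W k) (W (k + 1)) ⊆ sideHalfPlane .ccw s t := by
  have hle : ∀ k ≤ m + 1, W k ∈ {x | 0 ≤ (-1) * orient s t x} := by
    intro k hk
    rcases Nat.eq_zero_or_pos k with rfl | h0
    · simp [hW.start]
    rcases hk.eq_or_lt with rfl | h1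
    · simp [hW.finish]
    · have := hW.side k h0 h1
      simp only [mem_ofPred_eq]
      linarith
  intro x hx
  have := (convex_setOf_orient_nonneg (-1) s t).segment_subset (hle k hk.le) (hle (k + 1) hk) hx
  simp only [mem_ofPred_eq, sideHalfPlane, Direction.sign] at this ⊢
  linarith

lemma isOptimalDetour_ccw (hP : IsConvexPolygon P) {s t : Plane} {r : ℝ} (hr : 0 < r)
    (hr' : r < 1) (ho : AffineMap.lineMap s t r ∈ obstacle P) {i q : Fin n}
    (hi : IsFurthestSeenVertex P .ccw s i) (hq : IsFurthestSeenVertex P .cw t q) :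
    IsOptimalDetour P .ccw s t (AffineMap.lineMap s t r) i q := by
  have hW := isTautChain_detourPoint hP hr hr' ho hi hq
  constructor
  · obtain ⟨β, h1, h2, h3⟩ := exists_isPolygonalPath (detourPoint P s t i (q - i).val)
      ((q - i).val + 1)
    rw [← detour_ccw_eq] at h2
    rw [← detourLength_ccw_eq] at h3
    refine ⟨β.cast rfl hW.finish.symm, h1, h2, h3, ?_, ?_⟩
    · exact h2.trans_subset (detour_subset_freeSpace hP .ccw hi.1.2.1 hq.1.2.1)
    · refine (h2.trans (detour_ccw_eq P s t i q)).trans_subset ?_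
      exact iUnion₂_subset fun k hk => hW.segment_subset hk
  · intro γ hγ hpass
    rw [detour_ccw_eq, detourLength_ccw_eq]
    exact hW.le_pathLength (not_mem_obstacle_of_range hγ) hpass

/-- The clockwise case is the counterclockwise one for the reversed path from `t` to `s`, with the
same point `o` at parameter `1 - r`. -/
lemma isOptimalDetour (hP : IsConvexPolygon P) {s t : Plane} {r : ℝ} (hr : 0 < r)
    (hr' : r < 1) (ho : AffineMap.lineMap s t r ∈ obstacle P) (d : Direction) {i q : Fin n}
    (hi : IsFurthestSeenVertex P d s i) (hq : IsFurthestSeenVertex P d.reverse t q) :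
    IsOptimalDetour P d s t (AffineMap.lineMap s t r) i q := by
  cases d with
  | ccw => exact isOptimalDetour_ccw hP hr hr' ho hi hq
  | cw =>
    apply IsOptimalDetour.reverse
    have e : (AffineMap.lineMap s t r : Plane) = AffineMap.lineMap t s (1 - r) :=
      (AffineMap.lineMap_apply_one_sub t s r).symm
    rw [e] at ho ⊢
    exact isOptimalDetour_ccw hP (sub_pos.2 hr') (by linarith) ho hq hi

end Main

end ConvexObstacle

theorem mainTheorem5 {n : ℕ} [NeZero n] (P : Polygon Plane n) (hP : IsConvexPolygon P)
    (s t : Plane) (hs : s ∈ freeSpace P) (ht : t ∈ freeSpace P) (hst : ¬ Visible P s t) :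
    -- the vertices `v_i`, `v_q` exist and are unique, for each of the two directions
    (∀ d : Direction, ∃! k : Fin n, IsFurthestSeenVertex P d s k) ∧
    (∀ d : Direction, ∃! k : Fin n, IsFurthestSeenVertex P d.reverse t k) ∧
    ∀ i q : Direction → Fin n,
      (∀ d, IsFurthestSeenVertex P d s (i d)) →
      (∀ d, IsFurthestSeenVertex P d.reverse t (q d)) →
      -- for each direction, `B` is a polygonal path, and it is the shortest one among all the
      -- legal paths in the supporting half plane
      (∀ d : Direction,
        (∃ β : Path s t, IsPolygonalPath β ∧ range β = detour P d s t (i d) (q d) ∧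
          pathLength β = ENNReal.ofReal (detourLength P d s t (i d) (q d)) ∧
          IsShortestIn (legalPathsWithin P (sideHalfPlane d s t) s t) β) ∧
        (∀ γ : Path s t, IsShortestIn (legalPathsWithin P (sideHalfPlane d s t) s t) γ →
          range γ = detour P d s t (i d) (q d))) ∧
      -- shortest legal polygonal paths exist, are of the form `B` for one of the two directions,
      -- and are shortest among all legal paths
      (∃ γ : Path s t, IsShortestIn (legalPolygonalPaths P s t) γ) ∧
      (∀ γ : Path s t, IsShortestIn (legalPolygonalPaths P s t) γ →
        (∃ d : Direction, range γ = detour P d s t (i d) (q d) ∧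
          pathLength γ = ENNReal.ofReal (detourLength P d s t (i d) (q d))) ∧
        IsShortestIn (legalPaths P s t) γ) := by
  obtain ⟨r, hr, hr', ho⟩ := exists_lineMap_mem_obstacle hs ht hst
  have hO : (obstacle P).Nonempty := ⟨_, ho⟩
  have hne : s ≠ t := by
    rintro rfl
    exact hs (by simpa using ho)
  have huniq : ∀ p ∈ freeSpace P, ∀ d, ∃! k, IsFurthestSeenVertex P d p k := by
    intro p hp d
    obtain ⟨k, hk⟩ := exists_isFurthestSeenVertex hO hp d
    exact ⟨k, hk, fun j hj => hP.injective hO (hj.point_eq hO hk)⟩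
  refine ⟨huniq s hs, fun d => huniq t ht d.reverse, fun i q hi hq => ?_⟩
  have hopt := fun d => isOptimalDetour hP hr hr' ho d (hi d) (hq d)
  have hlow : ∀ γ ∈ legalPaths P s t, ∃ d,
      ENNReal.ofReal (detourLength P d s t (i d) (q d)) ≤ pathLength γ ∧
      (pathLength γ ≤ ENNReal.ofReal (detourLength P d s t (i d) (q d)) →
        range γ = detour P d s t (i d) (q d)) := by
    intro γ hγ
    obtain ⟨d, hd⟩ := exists_passesOn hne hr hr' γ
      (fun u h => not_mem_obstacle_of_range hγ u (h ▸ ho))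
    exact ⟨d, (hopt d).2 γ hγ hd⟩
  refine ⟨fun d => ?_, ?_⟩
  · obtain ⟨⟨β, h1, h2, h3, h4⟩, h5⟩ := hopt d
    refine ⟨⟨β, h1, h2, h3, h4, fun γ hγ => ?_⟩, fun γ hγ => ?_⟩
    · rw [h3]
      exact (h5 γ hγ.1 (passesOn_of_range_subset hγ.2 _)).1
    · refine (h5 γ hγ.1.1 (passesOn_of_range_subset hγ.1.2 _)).2 ?_
      rw [← h3]
      exact hγ.2 β h4
  · obtain ⟨d₀, hd₀⟩ : ∃ d₀ : Direction, ∀ d, detourLength P d₀ s t (i d₀) (q d₀) ≤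
        detourLength P d s t (i d) (q d) := by
      rcases le_total (detourLength P .ccw s t (i .ccw) (q .ccw))
        (detourLength P .cw s t (i .cw) (q .cw)) with h | h
      · exact ⟨.ccw, fun d => by cases d; exacts [le_rfl, h]⟩
      · exact ⟨.cw, fun d => by cases d; exacts [h, le_rfl]⟩
    obtain ⟨⟨β, h1, -, h3, h4⟩, -⟩ := hopt d₀
    have hβ : ∀ γ ∈ legalPaths P s t, pathLength β ≤ pathLength γ := by
      intro γ hγ
      obtain ⟨d, hd, -⟩ := hlow γ hγ
      rw [h3]
      exact (ENNReal.ofReal_le_ofReal (hd₀ d)).trans hd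
    refine ⟨⟨β, ⟨h4.1, h1⟩, fun γ hγ => hβ γ hγ.1⟩, fun γ hγ => ?_⟩
    have hγβ : pathLength γ ≤ pathLength β := hγ.2 β ⟨h4.1, h1⟩
    refine ⟨?_, hγ.1.1, fun γ' hγ' => hγβ.trans (hβ γ' hγ')⟩
    -- The side `d` on which `γ` passes need not be `d₀`; when it differs, the bounds force both
    -- detours to have the same length.
    obtain ⟨d, hd, hd'⟩ := hlow γ hγ.1.1
    have hle : pathLength γ ≤ ENNReal.ofReal (detourLength P d s t (i d) (q d)) :=
      hγβ.trans (h3 ▸ ENNReal.ofReal_le_ofReal (hd₀ d))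
    exact ⟨d, hd' hle, le_antisymm hle hd⟩
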